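/- Let $X$ be a proper Hadamard space (a complete CAT(0) space whose closed balls are compact) and let $\Gamma<\mathrm{Is}(X)$ be a subgroup of its isometry group that is discrete in the compact-open topology. A geodesic line $v$ of $X$ is called rank one if its transversal is bounded, that is if the set of origins $u(0)$ of the geodesic lines $u$ with $u^\pm=v^\pm$ and $\mathcal B_{v^-}(u(0),v(0))=0$ is bounded, where $v^\pm$ are the end points of $v$ in the geometric boundary $\partial X$ and $\mathcal B_\xi$ is the Busemann function centered at $\xi$. An isometry $g\neq\mathrm{id}$ of $X$ is called rank one if it translates some rank one geodesic line $v$ by a positive amount, $g\,v(t)=v(t+\ell)$ for all $t\in\mathbb R$ with some $\ell>0$; put $g^\pm=v^\pm$. Suppose that $\Gamma$ is a rank one group, that is, $\Gamma$ contains two rank one isometries $g,h$ with $\{g^-,g^+\}\cap\{h^-,h^+\}=\emptyset$. Fix $o\in X$. For a subgroup $G<\Gamma$ let $L_G=\overline{G o}\cap\partial X$ be its limit set (closure in $X\cup\partial X$ with the cone topology), let $$\delta_G=\limsup_{R\to\infty}\frac{\ln\#\{\gamma\in G: d(o,\gamma o)\le R\}}{R}\in[0,\infty]$$ be its critical exponent,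 and call $G$ divergent if $\delta_G<\infty$ and $\sum_{\gamma\in G}e^{-\delta_G d(o,\gamma o)}=\infty$; these notions do not depend on $o$. If $H<\Gamma$ is a divergent subgroup with $L_H\subsetneq L_\Gamma$, then $\delta_H<\delta_\Gamma$. -/

import Mathlib

open Set Filter Topology
open scoped NNReal

noncomputable section

namespace HadamardSpace

variable {X : Type*} [MetricSpace X]

/-- `σ` restricted to `[0, d(x,y)]` is a geodesic from `x` to `y`. -/
def IsGeodesicSegment (σ : ℝ → X) (x y : X) : Prop :=
  σ 0 = x ∧ σ (dist x y) = y ∧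
    ∀ s ∈ Icc 0 (dist x y), ∀ t ∈ Icc 0 (dist x y), dist (σ s) (σ t) = |s - t|

/-- A Hadamard space: a complete geodesic metric space all of whose geodesic triangles satisfy the
CAT(0)-inequality. Two points of a triangle lie on two sides with a common vertex `x`; the points
`x' y' z'` are the vertices of a comparison triangle in the Euclidean plane. -/
structure IsHadamard (X : Type*) [MetricSpace X] : Prop where
  complete : CompleteSpace X
  geodesic : ∀ x y : X, ∃ σ : ℝ → X, IsGeodesicSegment σ x y
  cat_zero : ∀ (x y z : X) (σ τ : ℝ → X), IsGeodesicSegment σ x y → IsGeodesicSegment τ x z →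
    ∀ x' y' z' : EuclideanSpace ℝ (Fin 2),
      dist x' y' = dist x y → dist x' z' = dist x z → dist y' z' = dist y z →
      ∀ s ∈ Icc (0 : ℝ) 1, ∀ t ∈ Icc (0 : ℝ) 1,
        dist (σ (s * dist x y)) (τ (t * dist x z)) ≤
          dist (AffineMap.lineMap x' y' s) (AffineMap.lineMap x' z' t)

variable (X) in
/-- Geodesic rays, that is isometric maps `[0, ∞) → X`. -/
structure GeodesicRay where
  toFun : ℝ≥0 → X
  isometry : Isometry toFun

variable (X) in
/-- (Parametrized) geodesic lines, that is isometric maps `ℝ → X`. -/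
structure GeodesicLine where
  toFun : ℝ → X
  isometry : Isometry toFun

instance : CoeFun (GeodesicRay X) (fun _ => ℝ≥0 → X) := ⟨GeodesicRay.toFun⟩

instance : CoeFun (GeodesicLine X) (fun _ => ℝ → X) := ⟨GeodesicLine.toFun⟩

/-- Two rays are asymptotic if they stay at bounded distance. -/
def Asymptotic (σ τ : GeodesicRay X) : Prop :=
  ∃ C : ℝ, ∀ t : ℝ≥0, dist (σ t) (τ t) ≤ C

variable (X) in
/-- Asymptoticity as an equivalence relation. -/
def asymptoticSetoid : Setoid (GeodesicRay X) where
  r := Asymptotic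
  iseqv :=
    { refl := fun σ => ⟨0, fun t => by simp⟩
      symm := fun {σ τ} ⟨C, hC⟩ => ⟨C, fun t => by rw [dist_comm]; exact hC t⟩
      trans := fun {σ τ ρ} ⟨C, hC⟩ ⟨D, hD⟩ =>
        ⟨C + D, fun t => (dist_triangle _ (τ t) _).trans (add_le_add (hC t) (hD t))⟩ }

variable (X) in
/-- The geometric boundary `∂X`: classes of asymptotic geodesic rays. -/
def Boundary : Type _ := Quotient (asymptoticSetoid X)

/-- The boundary point represented by a ray. -/
def GeodesicRay.endpoint (σ : GeodesicRay X) : Boundary X := Quotient.mk (asymptoticSetoid X) σ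

variable (X) in
/-- The set `X ∪ ∂X`. -/
def Bordification : Type _ := X ⊕ Boundary X

/-- The inclusion of `X` in `X ∪ ∂X`. -/
def ofPoint (x : X) : Bordification X := Sum.inl x

/-- The inclusion of `∂X` in `X ∪ ∂X`. -/
def ofBoundary (ξ : Boundary X) : Bordification X := Sum.inr ξ

/-- The points of `X ∪ ∂X` outside the closed `r`-ball about the origin of the ray `σ` whose
projection to that ball (along the geodesic or the ray issuing from the origin of `σ`) is at
distance less than `ε` from `σ r`. -/
def coneNeighborhood (σ : GeodesicRay X) (r : ℝ≥0) (ε : ℝ) : Set (Bordification X) :=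
  {p | (∃ y : X, p = ofPoint y ∧ (r : ℝ) < dist (σ 0) y ∧
          ∃ τ : ℝ → X, IsGeodesicSegment τ (σ 0) y ∧ dist (τ r) (σ r) < ε) ∨
       (∃ τ : GeodesicRay X, p = ofBoundary τ.endpoint ∧ τ 0 = σ 0 ∧ dist (τ r) (σ r) < ε)}

/-- The cone topology, generated by the open balls of `X` and the cone neighborhoods. -/
instance : TopologicalSpace (Bordification X) :=
  TopologicalSpace.generateFrom
    ({U | ∃ (x : X) (r : ℝ), U = ofPoint '' Metric.ball x r} ∪
     {U | ∃ (σ : GeodesicRay X) (r : ℝ≥0) (ε : ℝ), 0 < r ∧ 0 < ε ∧ U = coneNeighborhood σ r ε})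

/-- The Busemann function: `lim_{s → ∞} (d(x, σ(s)) - d(y, σ(s)))` for a ray `σ` in the class `ξ`.
In a Hadamard space the limit exists and does not depend on the ray. -/
def busemann (ξ : Boundary X) (x y : X) : ℝ :=
  limUnder atTop (fun s : ℝ≥0 => dist x (ξ.out s) - dist y (ξ.out s))

namespace GeodesicLine

/-- The positive ray of a geodesic line. -/
def posRay (v : GeodesicLine X) : GeodesicRay X where
  toFun t := v (t : ℝ)
  isometry := v.isometry.comp NNReal.isometry_coe

/-- The negative ray of a geodesic line. -/
def negRay (v : GeodesicLine X) : GeodesicRay X where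
  toFun t := v (-(t : ℝ))
  isometry := v.isometry.comp ((IsometryEquiv.neg ℝ).isometry.comp NNReal.isometry_coe)

/-- The positive end point `v⁺`. -/
def posEnd (v : GeodesicLine X) : Boundary X := v.posRay.endpoint

/-- The negative end point `v⁻`. -/
def negEnd (v : GeodesicLine X) : Boundary X := v.negRay.endpoint

/-- The Hopf parametrization with respect to `o`. -/
def hopf (o : X) (v : GeodesicLine X) : Boundary X × Boundary X × ℝ :=
  (v.negEnd, v.posEnd, busemann v.negEnd o (v 0))

/-- The transversal `C_v`: the origins of all lines with the same Hopf parameters as `v` (which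
does not depend on the base point of the Hopf parametrization). -/
def transversal (v : GeodesicLine X) : Set X :=
  {x | ∃ u : GeodesicLine X, (∀ o : X, hopf o u = hopf o v) ∧ u 0 = x}

/-- A geodesic line is rank one if its transversal is bounded. -/
def IsRankOne (v : GeodesicLine X) : Prop := Bornology.IsBounded v.transversal

end GeodesicLine

/-- `v` is an invariant geodesic of `γ`: for some `ℓ > 0` one has `γ (v t) = v (t + ℓ)`. -/
def IsInvariantGeodesic (γ : X ≃ᵢ X) (v : GeodesicLine X) : Prop :=
  ∃ ℓ : ℝ, 0 < ℓ ∧ ∀ t : ℝ, γ (v t) = v (t + ℓ)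

/-- A rank one isometry: an axial isometry with a rank one invariant geodesic. -/
def IsRankOneIsometry (γ : X ≃ᵢ X) : Prop :=
  γ ≠ 1 ∧ ∃ v : GeodesicLine X, IsInvariantGeodesic γ v ∧ v.IsRankOne

/-- `{g⁻, g⁺} ∩ {h⁻, h⁺} = ∅`, where `g⁻, g⁺` are the end points of an invariant geodesic of the
axial isometry `g` (they do not depend on the geodesic). -/
def Independent (g h : X ≃ᵢ X) : Prop :=
  ∀ v w : GeodesicLine X, IsInvariantGeodesic g v → IsInvariantGeodesic h w →
    Disjoint ({v.negEnd, v.posEnd} : Set (Boundary X)) {w.negEnd, w.posEnd}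

/-- A rank one group contains two independent rank one isometries. -/
def IsRankOneGroup (Γ : Subgroup (X ≃ᵢ X)) : Prop :=
  ∃ g ∈ Γ, ∃ h ∈ Γ, IsRankOneIsometry g ∧ IsRankOneIsometry h ∧ Independent g h

/-- The compact-open topology on the isometry group. -/
instance : TopologicalSpace (X ≃ᵢ X) :=
  TopologicalSpace.induced (fun g => (⟨g, g.continuous⟩ : C(X, X))) inferInstance

/-- The geometric limit set: the boundary points in the closure of the orbit of `o`. -/
def limitSet (Γ : Subgroup (X ≃ᵢ X)) (o : X) : Set (Boundary X) :=
  {ξ | ofBoundary ξ ∈ closure (ofPoint '' {x : X | ∃ γ ∈ Γ, γ o = x})}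

/-- The orbit counting function (finite for discrete groups of a proper space). -/
def orbitCount (Γ : Subgroup (X ≃ᵢ X)) (o : X) (R : ℝ) : ℕ :=
  {γ : X ≃ᵢ X | γ ∈ Γ ∧ dist o (γ o) ≤ R}.ncard

/-- The critical exponent, a number in `[0, ∞]`. -/
def criticalExponent (Γ : Subgroup (X ≃ᵢ X)) (o : X) : EReal :=
  limsup (fun R : ℝ => ((Real.log (orbitCount Γ o R) / R : ℝ) : EReal)) atTop

/-- A divergent group: the critical exponent is finite and the Poincaré series diverges there. -/
def IsDivergent (Γ : Subgroup (X ≃ᵢ X)) (o : X) : Prop :=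
  criticalExponent Γ o ≠ ⊤ ∧
    ¬ Summable (fun γ : Γ =>
        Real.exp (-(criticalExponent Γ o).toReal * dist o ((γ : X ≃ᵢ X) o)))

end HadamardSpace

end

open Set Filter Topology
open scoped NNReal

namespace HadamardSpace

variable {X : Type*} [MetricSpace X]

/-! The proof is a ping-pong argument followed by a comparison of Poincaré series. A boundary point
in the limit set of `Γ` but not in that of `H`, together with two independent rank one elements,
yields `g ∈ Γ` with a rank one axis `w` to which the orbit `H o` has bounded projection
(`exists_axis_with_bounded_projection`). Let `U` be the set of points projecting far out on the
positive half of `w`. Elements of `H` that move `o` far map `U` off `U`, and a fixed high power `a`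
of `g` brings the image back into `U` (`IsContracting.abs_lt_of_near`, `exists_pingpong`).

The geometric input is that a rank one axis is contracting: a geodesic between points with distant
projections passes near the part of the axis in between (`IsRankOneAxis.isContracting`). This rests
on compactness: counterexamples, translated back along the axis, converge to a parallel of the axis
that is too far away, against the boundedness of the transversal
(`IsRankOneAxis.not_exists_segment`).

For the series, take a subset of `H` so separated that quotients of distinct elements are long. By
ping-pong, distinct words of length `k` in the products `a * b` are distinct elements of `Γ`, and
they contribute at least `A(s) ^ k` to the series of `Γ` at `s`, where `A(s)` is the sum of `exp (-s
(d(o, a o) + d(o, b o)))`. As `H` is divergent, finitely many `b` suffice for `A(δ_H) > 1`. By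
continuity `A(s) > 1` for some `s > δ_H`; the series of `Γ` diverges there, hence `δ_Γ ≥ s`. -/

/-! ### Comparison triangles and geodesics in a Hadamard space -/

theorem exists_comparison_triangle (x y z : X) :
    ∃ x' y' z' : EuclideanSpace ℝ (Fin 2),
      dist x' y' = dist x y ∧ dist x' z' = dist x z ∧ dist y' z' = dist y z := by
  have ha : 0 ≤ dist x y := dist_nonneg
  have hb : 0 ≤ dist x z := dist_nonneg
  have hc : 0 ≤ dist y z := dist_nonneg
  have h1 : dist x y ≤ dist x z + dist y z := by
    have := dist_triangle x z y; rwa [dist_comm z y] at this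
  have h2 : dist x z ≤ dist x y + dist y z := dist_triangle x y z
  have h3 : dist y z ≤ dist x y + dist x z := by
    have := dist_triangle y x z; rwa [dist_comm y x] at this
  generalize dist x y = a at *
  generalize dist x z = b at *
  generalize dist y z = c at *
  rcases ha.eq_or_lt with h0 | h0
  · subst h0
    have hbc : b = c := by linarith
    subst hbc
    refine ⟨!₂[0, 0], !₂[0, 0], !₂[b, 0], ?_, ?_, ?_⟩ <;>
      simp [EuclideanSpace.dist_eq, Real.sqrt_sq_eq_abs, Real.dist_eq, abs_of_nonneg hb]
  -- By the law of cosines `u` is the abscissa of `z'` once `x' y'` lies on the first axis; `b² - u²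
  -- ≥ 0` is Heron's factorization.
  · set u := (a ^ 2 + b ^ 2 - c ^ 2) / (2 * a) with hu
    have hua : 2 * a * u = a ^ 2 + b ^ 2 - c ^ 2 := by rw [hu]; field_simp
    have hnn : 0 ≤ b ^ 2 - u ^ 2 := by
      have key : (4 * a ^ 2) * (b ^ 2 - u ^ 2) =
          ((a + b - c) * (a + b + c)) * ((c - a + b) * (c + a - b)) := by
        have : (4 * a ^ 2) * (b ^ 2 - u ^ 2) = 4 * a ^ 2 * b ^ 2 - (2 * a * u) ^ 2 := by ring
        rw [this, hua]; ring
      have hpos : 0 ≤ (4 * a ^ 2) * (b ^ 2 - u ^ 2) := by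
        rw [key]
        exact mul_nonneg (mul_nonneg (by linarith) (by linarith))
          (mul_nonneg (by linarith) (by linarith))
      exact nonneg_of_mul_nonneg_right hpos (by positivity)
    have hs := Real.sq_sqrt hnn
    refine ⟨!₂[0, 0], !₂[a, 0], !₂[u, √(b ^ 2 - u ^ 2)], ?_, ?_, ?_⟩
    · simp [EuclideanSpace.dist_eq, Real.dist_eq, Real.sqrt_sq_eq_abs, abs_of_nonneg ha]
    · simp only [EuclideanSpace.dist_eq, Real.dist_eq, Fin.sum_univ_two, sq_abs]
      rw [Real.sqrt_eq_iff_eq_sq (by positivity) hb]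
      simp [hs]
    · simp only [EuclideanSpace.dist_eq, Real.dist_eq, Fin.sum_univ_two, sq_abs]
      rw [Real.sqrt_eq_iff_eq_sq (by positivity) hc]
      simp [hs]
      linarith

theorem dist_sq_lineMap (x y z : EuclideanSpace ℝ (Fin 2)) (s : ℝ) :
    dist (AffineMap.lineMap x y s) z ^ 2 =
      (1 - s) * dist x z ^ 2 + s * dist y z ^ 2 - s * (1 - s) * dist x y ^ 2 := by
  simp only [EuclideanSpace.dist_eq, Real.dist_eq, Fin.sum_univ_two, sq_abs]
  rw [Real.sq_sqrt (by positivity), Real.sq_sqrt (by positivity), Real.sq_sqrt (by positivity),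
    Real.sq_sqrt (by positivity)]
  simp [AffineMap.lineMap_apply]
  ring

theorem mul_mem_Icc_of_mem_unitInterval {a s : ℝ} (hs : s ∈ Icc (0 : ℝ) 1) (ha : 0 ≤ a) :
    s * a ∈ Icc 0 a :=
  ⟨mul_nonneg hs.1 ha, mul_le_of_le_one_left ha hs.2⟩

namespace IsHadamard

/-- The point dividing the geodesic from `x` to `y` in the ratio `s : 1 - s`. -/
noncomputable def pt (hX : IsHadamard X) (x y : X) (s : ℝ) : X :=
  (hX.geodesic x y).choose (s * dist x y)

variable (hX : IsHadamard X)
include hX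

theorem pt_spec (x y : X) : IsGeodesicSegment (hX.geodesic x y).choose x y :=
  (hX.geodesic x y).choose_spec

@[simp] theorem pt_zero (x y : X) : hX.pt x y 0 = x := by
  simp [pt, (hX.pt_spec x y).1]

@[simp] theorem pt_one (x y : X) : hX.pt x y 1 = y := by
  simp [pt, (hX.pt_spec x y).2.1]

theorem dist_pt_pt (x y : X) {s t : ℝ} (hs : s ∈ Icc (0 : ℝ) 1) (ht : t ∈ Icc (0 : ℝ) 1) :
    dist (hX.pt x y s) (hX.pt x y t) = |s - t| * dist x y := by
  rw [pt, pt, (hX.pt_spec x y).2.2 _ (mul_mem_Icc_of_mem_unitInterval hs dist_nonneg) _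
      (mul_mem_Icc_of_mem_unitInterval ht dist_nonneg),
    ← sub_mul, abs_mul, abs_of_nonneg (dist_nonneg (x := x) (y := y))]

theorem dist_left_pt (x y : X) {s : ℝ} (hs : s ∈ Icc (0 : ℝ) 1) :
    dist x (hX.pt x y s) = s * dist x y := by
  have := hX.dist_pt_pt x y (s := 0) (by simp) hs
  rw [hX.pt_zero] at this
  rw [this]; simp [abs_of_nonneg hs.1]

theorem dist_pt_right (x y : X) {s : ℝ} (hs : s ∈ Icc (0 : ℝ) 1) :
    dist (hX.pt x y s) y = (1 - s) * dist x y := by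
  have := hX.dist_pt_pt x y hs (t := 1) (by simp)
  rw [hX.pt_one] at this
  rw [this, abs_sub_comm, abs_of_nonneg (by linarith [hs.2])]

/-- The CAT(0) inequality between a point of one side and the opposite vertex, with the Euclidean
side evaluated by Stewart's theorem. -/
theorem dist_pt_sq_le (x y z : X) {s : ℝ} (hs : s ∈ Icc (0 : ℝ) 1) :
    dist (hX.pt x y s) z ^ 2 ≤
      (1 - s) * dist x z ^ 2 + s * dist y z ^ 2 - s * (1 - s) * dist x y ^ 2 := by
  obtain ⟨x', y', z', h1, h2, h3⟩ := exists_comparison_triangle x y z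
  have h := hX.cat_zero x y z _ _ (hX.pt_spec x y) (hX.pt_spec x z) x' y' z' h1 h2 h3 s hs 1
    (by simp)
  rw [one_mul, (hX.pt_spec x z).2.1, AffineMap.lineMap_apply_one] at h
  have h' := pow_le_pow_left₀ dist_nonneg h 2
  rwa [dist_sq_lineMap, h1, h2, h3] at h'

/-- Uniqueness of geodesics: for such `z` the right side of `dist_pt_sq_le` vanishes. -/
theorem eq_pt {x y z : X} {s : ℝ} (hs : s ∈ Icc (0 : ℝ) 1) (h1 : dist x z = s * dist x y)
    (h2 : dist z y = (1 - s) * dist x y) : z = hX.pt x y s := by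
  have h := hX.dist_pt_sq_le x y z hs
  rw [h1, dist_comm y z, h2] at h
  have h0 : dist (hX.pt x y s) z ^ 2 ≤ 0 := h.trans (by ring_nf; rfl)
  have : dist (hX.pt x y s) z = 0 := by
    have := sq_nonneg (dist (hX.pt x y s) z)
    exact pow_eq_zero_iff (two_ne_zero) |>.1 (le_antisymm h0 this)
  exact (dist_eq_zero.1 this).symm

theorem dist_pt_pt_same_left (x y z : X) {s : ℝ} (hs : s ∈ Icc (0 : ℝ) 1) :
    dist (hX.pt x y s) (hX.pt x z s) ≤ s * dist y z := by
  obtain ⟨x', y', z', h1, h2, h3⟩ := exists_comparison_triangle x y z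
  have h := hX.cat_zero x y z _ _ (hX.pt_spec x y) (hX.pt_spec x z) x' y' z' h1 h2 h3 s hs s hs
  refine h.trans (le_of_eq ?_)
  rw [← h3, AffineMap.lineMap_apply, AffineMap.lineMap_apply, dist_vadd_cancel_right,
    dist_smul₀, Real.norm_of_nonneg hs.1, dist_vsub_cancel_right]

theorem pt_symm (x y : X) {s : ℝ} (hs : s ∈ Icc (0 : ℝ) 1) :
    hX.pt y x s = hX.pt x y (1 - s) := by
  have hs' : 1 - s ∈ Icc (0 : ℝ) 1 := ⟨by linarith [hs.2], by linarith [hs.1]⟩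
  refine hX.eq_pt hs' ?_ ?_
  · rw [dist_comm, hX.dist_pt_right y x hs, dist_comm]
  · rw [dist_comm, hX.dist_left_pt y x hs, dist_comm]; ring

/-- Convexity of the distance along a pair of geodesics. -/
theorem dist_pt_pt_le (x y x' y' : X) {s : ℝ} (hs : s ∈ Icc (0 : ℝ) 1) :
    dist (hX.pt x y s) (hX.pt x' y' s) ≤ (1 - s) * dist x x' + s * dist y y' := by
  have hs' : 1 - s ∈ Icc (0 : ℝ) 1 := ⟨by linarith [hs.2], by linarith [hs.1]⟩
  have h1 := hX.dist_pt_pt_same_left x y y' hs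
  have h2 := hX.dist_pt_pt_same_left y' x x' hs'
  rw [hX.pt_symm x y' hs', hX.pt_symm x' y' hs', sub_sub_cancel] at h2
  linarith [dist_triangle (hX.pt x y s) (hX.pt x y' s) (hX.pt x' y' s)]

theorem pt_pt_left (x y : X) {s t : ℝ} (hs : s ∈ Icc (0 : ℝ) 1) (ht : t ∈ Icc (0 : ℝ) 1) :
    hX.pt x (hX.pt x y s) t = hX.pt x y (t * s) := by
  have hts : t * s ∈ Icc (0 : ℝ) 1 := ⟨mul_nonneg ht.1 hs.1, mul_le_one₀ ht.2 hs.1 hs.2⟩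
  symm
  refine hX.eq_pt ht ?_ ?_
  · rw [hX.dist_left_pt x y hts, hX.dist_left_pt x y hs]; ring
  · rw [hX.dist_pt_pt x y hts hs, hX.dist_left_pt x y hs, abs_sub_comm, abs_of_nonneg]
    · ring
    · nlinarith [hs.1, ht.2]

theorem map_pt (γ : X ≃ᵢ X) (x y : X) {s : ℝ} (hs : s ∈ Icc (0 : ℝ) 1) :
    γ (hX.pt x y s) = hX.pt (γ x) (γ y) s := by
  refine hX.eq_pt hs ?_ ?_
  · rw [γ.dist_eq, γ.dist_eq, hX.dist_left_pt x y hs]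
  · rw [γ.dist_eq, γ.dist_eq, hX.dist_pt_right x y hs]

theorem pt_line {v : ℝ → X} (hv : Isometry v) (a b : ℝ) {s : ℝ} (hs : s ∈ Icc (0 : ℝ) 1) :
    hX.pt (v a) (v b) s = v (a + s * (b - a)) := by
  symm
  refine hX.eq_pt hs ?_ ?_
  · rw [hv.dist_eq, hv.dist_eq, Real.dist_eq, Real.dist_eq,
      show a - (a + s * (b - a)) = s * (a - b) by ring, abs_mul, abs_of_nonneg hs.1]
  · rw [hv.dist_eq, hv.dist_eq, Real.dist_eq, Real.dist_eq,
      show a + s * (b - a) - b = (1 - s) * (a - b) by ring, abs_mul,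
      abs_of_nonneg (show 0 ≤ 1 - s by linarith [hs.2])]

theorem pt_ray (σ : GeodesicRay X) (b : ℝ≥0) {s : ℝ≥0} (hs : s ≤ 1) :
    hX.pt (σ 0) (σ b) s = σ (s * b) := by
  have hs' : (s : ℝ) ∈ Icc (0 : ℝ) 1 := ⟨s.2, by exact_mod_cast hs⟩
  symm
  refine hX.eq_pt hs' ?_ ?_
  · rw [σ.isometry.dist_eq, σ.isometry.dist_eq, NNReal.dist_eq, NNReal.dist_eq]
    simp [abs_mul]
  · rw [σ.isometry.dist_eq, σ.isometry.dist_eq, NNReal.dist_eq, NNReal.dist_eq]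
    have : ((s * b : ℝ≥0) : ℝ) - b = -((1 - s) * b) := by push_cast; ring
    rw [this, abs_neg, abs_mul, abs_of_nonneg (show (0 : ℝ) ≤ 1 - s by linarith [hs'.2])]
    simp

theorem dist_pt_point_le (x y z : X) {s : ℝ} (hs : s ∈ Icc (0 : ℝ) 1) :
    dist z (hX.pt x y s) ≤ (1 - s) * dist z x + s * dist z y := by
  have h := hX.dist_pt_pt_le z z x y hs
  have hz : hX.pt z z s = z := by
    refine (hX.eq_pt hs ?_ ?_).symm <;> simp
  rwa [hz] at h

/-- Points at the same distance `r` from `o` on the geodesics from `o` to `a` and to `b`. -/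
theorem dist_pt_div_le (o a b : X) {r : ℝ} (hr : 0 ≤ r) (hra : r ≤ dist o a) (hrb : r ≤ dist o b)
    (ha : 0 < dist o a) (hb : 0 < dist o b) :
    dist (hX.pt o a (r / dist o a)) (hX.pt o b (r / dist o b)) ≤
      2 * (r / dist o a) * dist a b := by
  have hsa : r / dist o a ∈ Icc (0 : ℝ) 1 := ⟨by positivity, (div_le_one ha).2 hra⟩
  have hsb : r / dist o b ∈ Icc (0 : ℝ) 1 := ⟨by positivity, (div_le_one hb).2 hrb⟩
  have h1 := hX.dist_pt_pt_same_left o a b hsa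
  have h2 := hX.dist_pt_pt o b hsa hsb
  have h3 : |r / dist o a - r / dist o b| * dist o b = (r / dist o a) * |dist o b - dist o a| := by
    have : r / dist o a - r / dist o b = (r / dist o a) * (dist o b - dist o a) / dist o b := by
      field_simp
    rw [this, abs_div, abs_mul, abs_of_nonneg hsa.1, abs_of_pos hb]
    field_simp
  have h4 : |dist o b - dist o a| ≤ dist a b := by
    rw [abs_le]; constructor
    · linarith [dist_triangle o b a, dist_comm a b]
    · linarith [dist_triangle o a b]
  have h5 := mul_le_mul_of_nonneg_left h4 hsa.1
  linarith [dist_triangle (hX.pt o a (r / dist o a)) (hX.pt o b (r / dist o a))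
    (hX.pt o b (r / dist o b))]

end IsHadamard

/-! ### Projections to lines, horofunctions and parallels of rank one lines -/

/-- `t` minimizes the distance of `w t` from `x`. -/
def Near (w : ℝ → X) (x : X) (t : ℝ) : Prop := ∀ s, dist x (w t) ≤ dist x (w s)

theorem exists_near [ProperSpace X] {w : ℝ → X} (hw : Isometry w) (x : X) : ∃ t, Near w x t := by
  have hcont : Continuous fun t => dist x (w t) := continuous_const.dist hw.continuous
  refine hcont.exists_forall_le ?_
  have hl : Tendsto (fun t : ℝ => |t| - dist x (w 0)) (cocompact ℝ) atTop :=
    tendsto_atTop_add_const_right _ _ (tendsto_norm_cocompact_atTop (E := ℝ))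
  refine tendsto_atTop_mono (fun t => ?_) hl
  have h1 : dist (w t) (w 0) = |t| := by rw [hw.dist_eq]; simp
  linarith [dist_triangle (w t) x (w 0), dist_comm (w t) x]

/-- The horofunction `lim_{s → ∞} (d(x, σ(s)) - s)` of a ray. -/
noncomputable def GeodesicRay.horo (σ : GeodesicRay X) (x : X) : ℝ :=
  ⨅ s : ℝ≥0, (dist x (σ s) - s)

theorem GeodesicRay.dist_zero (σ : GeodesicRay X) (s : ℝ≥0) : dist (σ 0) (σ s) = s := by
  rw [σ.isometry.dist_eq, NNReal.dist_eq]; simp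

/-- The function is nonincreasing in `s` and bounded below by `-dist x (σ 0)`. -/
theorem GeodesicRay.tendsto_horo (σ : GeodesicRay X) (x : X) :
    Tendsto (fun s : ℝ≥0 => dist x (σ s) - s) atTop (𝓝 (σ.horo x)) := by
  refine tendsto_atTop_ciInf (fun s t hst => ?_) ⟨-dist x (σ 0), ?_⟩
  · have h1 : dist (σ s) (σ t) = t - s := by
      rw [σ.isometry.dist_eq, NNReal.dist_eq, abs_sub_comm, abs_of_nonneg]
      exact sub_nonneg.2 (by exact_mod_cast hst)
    have := dist_triangle x (σ s) (σ t)
    linarith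
  · rintro _ ⟨s, rfl⟩
    have := dist_triangle (σ 0) x (σ s)
    rw [σ.dist_zero, dist_comm _ x] at this
    dsimp only
    linarith

theorem busemann_eq_horo (ξ : Boundary X) (x y : X) :
    busemann ξ x y = (Quotient.out ξ).horo x - (Quotient.out ξ).horo y := by
  refine Tendsto.limUnder_eq ?_
  have := ((Quotient.out ξ).tendsto_horo x).sub ((Quotient.out ξ).tendsto_horo y)
  refine this.congr fun s => ?_
  ring

theorem GeodesicRay.horo_lipschitz (σ : GeodesicRay X) : LipschitzWith 1 σ.horo := by
  refine LipschitzWith.of_le_add fun x y => ?_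
  refine le_of_tendsto_of_tendsto' (σ.tendsto_horo x)
    ((σ.tendsto_horo y).add_const (dist x y)) fun s => ?_
  linarith [dist_triangle x y (σ s)]

theorem out_asymptotic (σ : GeodesicRay X) : Asymptotic (Quotient.out σ.endpoint) σ :=
  Quotient.exact (s := asymptoticSetoid X) (Quotient.out_eq _)

/-- A parallel of a rank one line passes at bounded distance of its origin. -/
theorem GeodesicLine.IsRankOne.exists_bound {v : GeodesicLine X} (hv : v.IsRankOne) :
    ∃ R₀ : ℝ, ∀ u : ℝ → X, Isometry u → (∃ C, ∀ t, dist (u t) (v t) ≤ C) →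
      ∃ s, dist (v 0) (u s) ≤ R₀ := by
  obtain ⟨R₀, hR₀⟩ := hv.subset_closedBall (v 0)
  refine ⟨R₀, fun u hu ⟨C, hC⟩ => ?_⟩
  set σ : GeodesicRay X := Quotient.out v.negEnd with hσ
  obtain ⟨D, hD⟩ : Asymptotic σ v.negRay := out_asymptotic v.negRay
  have hb : ∀ t, |σ.horo (u t) - t| ≤ C + D := by
    intro t
    have hl := ((σ.tendsto_horo (u t)).sub_const t).abs
    refine le_of_tendsto hl ?_
    filter_upwards [eventually_ge_atTop (Real.toNNReal (-t))] with s hs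
    have hs' : -t ≤ s := Real.toNNReal_le_iff_le_coe.1 hs
    have h1 : dist (u t) (u (-(s : ℝ))) = s + t := by
      rw [hu.dist_eq, Real.dist_eq, abs_of_nonneg (by linarith)]; ring
    have h2 : dist (u (-(s : ℝ))) (σ s) ≤ C + D := by
      have := hD s
      rw [dist_comm] at this
      exact (dist_triangle _ (v (-(s : ℝ))) _).trans (add_le_add (hC _) this)
    rw [abs_le]; constructor
    · linarith [dist_triangle (u t) (σ s) (u (-(s : ℝ))), dist_comm (σ s) (u (-(s : ℝ)))]
    · linarith [dist_triangle (u t) (u (-(s : ℝ))) (σ s)]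
  have hcont : Continuous fun t => σ.horo (u t) := σ.horo_lipschitz.continuous.comp hu.continuous
  -- Along `u` the horofunction differs from the parameter by a bounded amount, so it takes every
  -- value. Shifting `u` by `t` matches the Busemann coordinate of `v`, which puts the new origin in
  -- the transversal.
  obtain ⟨t, ht⟩ : ∃ t, σ.horo (u t) = σ.horo (v 0) := by
    refine mem_range_of_exists_le_of_exists_ge hcont
      ⟨σ.horo (v 0) - (C + D), ?_⟩ ⟨σ.horo (v 0) + (C + D), ?_⟩
    · linarith [abs_le.1 (hb (σ.horo (v 0) - (C + D)))]
    · linarith [abs_le.1 (hb (σ.horo (v 0) + (C + D)))]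
  refine ⟨t, ?_⟩
  have hd : ∀ s, dist (u (s + t)) (v s) ≤ C + |t| := fun s => by
    have h1 : dist (v (s + t)) (v s) = |t| := by
      rw [v.isometry.dist_eq, Real.dist_eq]; congr 1; ring
    linarith [dist_triangle (u (s + t)) (v (s + t)) (v s), hC (s + t)]
  let u' : GeodesicLine X :=
    ⟨fun s => u (s + t), hu.comp (Isometry.of_dist_eq fun a b => by simp)⟩
  have hneg : u'.negEnd = v.negEnd :=
    Quotient.sound (s := asymptoticSetoid X) ⟨C + |t|, fun s => hd (-(s : ℝ))⟩
  have hpos : u'.posEnd = v.posEnd :=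
    Quotient.sound (s := asymptoticSetoid X) ⟨C + |t|, fun s => hd (s : ℝ)⟩
  have hmem : u' 0 ∈ v.transversal := by
    refine ⟨u', fun o => ?_, rfl⟩
    have h0 : u' 0 = u t := by simp [u']
    simp only [hopf, hneg, hpos, busemann_eq_horo, h0]
    rw [← hσ, ht]
  have := hR₀ hmem
  rw [Metric.mem_closedBall, dist_comm] at this
  simpa [u'] using this

/-! ### Rank one axes: compactness and slopes of distance functions -/

/-- A periodic geodesic line: `g` translates `v` by `ℓ`, and parallels of `v` are close to `v 0`. -/
structure IsRankOneAxis (g : X ≃ᵢ X) (v : ℝ → X) (ℓ : ℝ) : Prop where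
  isometry : Isometry v
  pos : 0 < ℓ
  apply : ∀ t, g (v t) = v (t + ℓ)
  bound : ∃ R₀ : ℝ, ∀ u : ℝ → X, Isometry u → (∃ C, ∀ t, dist (u t) (v t) ≤ C) →
      ∃ s, dist (v 0) (u s) ≤ R₀

theorem pow_apply_axis {g : X ≃ᵢ X} {v : ℝ → X} {ℓ : ℝ} (h : ∀ t, g (v t) = v (t + ℓ)) (n : ℕ)
    (t : ℝ) : (g ^ n) (v t) = v (t + n * ℓ) := by
  induction n generalizing t with
  | zero => simp
  | succ k ih =>
    rw [pow_succ, IsometryEquiv.mul_apply, h, ih]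
    congr 1; push_cast; ring

theorem exists_iso_translate {g : X ≃ᵢ X} {v : ℝ → X} {ℓ : ℝ} (h : ∀ t, g (v t) = v (t + ℓ))
    (k : ℤ) : ∃ γ : X ≃ᵢ X, ∀ t, γ (v t) = v (t + k * ℓ) := by
  obtain ⟨n, rfl | rfl⟩ := k.eq_nat_or_neg
  · exact ⟨g ^ n, fun t => by simpa using pow_apply_axis h n t⟩
  · refine ⟨(g ^ n)⁻¹, fun t => ?_⟩
    have := pow_apply_axis h n (t - n * ℓ)
    rw [sub_add_cancel] at this
    rw [← this, ← IsometryEquiv.mul_apply, inv_mul_cancel]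
    change v _ = v _
    congr 1; push_cast; ring

/-- One fixed ultrafilter provides limits for all parameters of a family of curves at once, in place
of a diagonal subsequence. -/
theorem exists_tendsto_hyperfilter [ProperSpace X] {f : ℕ → X} {c : X} {r : ℝ}
    (h : ∀ᶠ n in atTop, dist (f n) c ≤ r) : ∃ x, Tendsto f (hyperfilter ℕ) (𝓝 x) := by
  have h' : ∀ᶠ n in (hyperfilter ℕ : Filter ℕ), dist (f n) c ≤ r := Nat.hyperfilter_le_atTop h
  obtain ⟨x, -, hx⟩ := (isCompact_closedBall c r).ultrafilter_le_nhds ((hyperfilter ℕ).map f)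
    
    (by rw [Filter.le_principal_iff]; exact h')
  exact ⟨x, hx⟩

/-- Long segments close to a rank one axis cannot stay too far from a point of the axis. -/
theorem IsRankOneAxis.not_exists_segment [ProperSpace X] {g : X ≃ᵢ X} {v : ℝ → X} {ℓ : ℝ}
    (h : IsRankOneAxis g v ℓ) :
    ∃ R₁ : ℝ, 1 ≤ R₁ ∧ ∀ C : ℝ, ∃ n : ℕ, ∀ a : ℝ, ¬ ∃ f : ℝ → X,
      (∀ s t : ℝ, |s| ≤ n → |t| ≤ n → abs (dist (f s) (f t) - |s - t|) ≤ 1 / ((n : ℝ) + 1)) ∧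
      ∀ t : ℝ, |t| ≤ n → dist (f t) (v (a + t)) ≤ C ∧ R₁ ≤ dist (v a) (f t) := by
  obtain ⟨R₀, hR₀⟩ := h.bound
  refine ⟨max R₀ 0 + ℓ + 1, by linarith [le_max_right R₀ 0, h.pos], fun C => ?_⟩
  -- `R₁` must not depend on `C`. Translations along the axis move `a n` into `[0, ℓ]`; the limit
  -- `u` of the translated segments is a parallel of `v`, so it comes within `R₀` of `v 0`, whereas
  -- the segments stay at distance `R₀ + 1`.
  by_contra! hcon
  choose a f hf1 hf2 using hcon
  choose γ hγ using fun n => exists_iso_translate h.apply (-⌊a n / ℓ⌋)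
  have hr : ∀ n, 0 ≤ a n + (-⌊a n / ℓ⌋ : ℤ) * ℓ ∧ a n + (-⌊a n / ℓ⌋ : ℤ) * ℓ ≤ ℓ := by
    intro n
    have h1 : (⌊a n / ℓ⌋ : ℝ) * ℓ ≤ a n := by
      have := mul_le_mul_of_nonneg_right (Int.floor_le (a n / ℓ)) h.pos.le
      rwa [div_mul_cancel₀ _ h.pos.ne'] at this
    have h2 : a n ≤ ((⌊a n / ℓ⌋ : ℝ) + 1) * ℓ := by
      have := mul_le_mul_of_nonneg_right (Int.lt_floor_add_one (a n / ℓ)).le h.pos.le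
      rwa [div_mul_cancel₀ _ h.pos.ne'] at this
    push_cast
    constructor <;> linarith
  set r : ℕ → ℝ := fun n => a n + (-⌊a n / ℓ⌋ : ℤ) * ℓ with hrdef
  have hclose : ∀ (n : ℕ) (t : ℝ), |t| ≤ n → dist (γ n (f n t)) (v t) ≤ C + ℓ := by
    intro n t ht
    have h1 : dist (γ n (f n t)) (v (r n + t)) ≤ C := by
      have := (hf2 n t ht).1
      rw [← (γ n).dist_eq, hγ] at this
      convert this using 3; simp only [hrdef]; ring
    have h2 : dist (v (r n + t)) (v t) ≤ ℓ := by
      rw [h.isometry.dist_eq, Real.dist_eq, add_sub_cancel_right, abs_of_nonneg (hr n).1]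
      exact (hr n).2
    linarith [dist_triangle (γ n (f n t)) (v (r n + t)) (v t)]
  have hev : ∀ t : ℝ, ∀ᶠ n : ℕ in atTop, |t| ≤ n := fun t =>
    (tendsto_natCast_atTop_atTop (R := ℝ)).eventually_ge_atTop _
  choose u hu using fun t : ℝ => exists_tendsto_hyperfilter (f := fun n => γ n (f n t))
    (c := v t) (r := C + ℓ) ((hev t).mono fun n hn => hclose n t hn)
  have hev' : ∀ t : ℝ, ∀ᶠ n : ℕ in (hyperfilter ℕ : Filter ℕ), |t| ≤ n := fun t =>
    Nat.hyperfilter_le_atTop (hev t)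
  have hiso : Isometry u := by
    refine Isometry.of_dist_eq fun s t => ?_
    have h1 : Tendsto (fun n => dist (γ n (f n s)) (γ n (f n t)) - |s - t|) (hyperfilter ℕ)
        (𝓝 (dist (u s) (u t) - |s - t|)) := ((hu s).dist (hu t)).sub_const _
    have h2 : Tendsto (fun n : ℕ => 1 / ((n : ℝ) + 1)) (hyperfilter ℕ) (𝓝 0) :=
      tendsto_one_div_add_atTop_nhds_zero_nat.mono_left Nat.hyperfilter_le_atTop
    have h3 := le_of_tendsto_of_tendsto h1.abs h2 (by
      filter_upwards [hev' s, hev' t] with n hs ht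
      rw [(γ n).dist_eq]
      exact hf1 n s t hs ht)
    rw [Real.dist_eq]
    linarith [abs_nonpos_iff.1 h3]
  obtain ⟨s, hs⟩ := hR₀ u hiso ⟨C + ℓ, fun t => le_of_tendsto ((hu t).dist tendsto_const_nhds)
    ((hev' t).mono fun n hn => hclose n t hn)⟩
  have hfar : R₀ + 1 ≤ dist (v 0) (u s) := by
    refine ge_of_tendsto (tendsto_const_nhds.dist (hu s)) ?_
    filter_upwards [hev' s] with n hn
    have h1 := (hf2 n s hn).2
    rw [← (γ n).dist_eq, hγ] at h1
    have h2 : dist (v 0) (v (r n)) ≤ ℓ := by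
      rw [h.isometry.dist_eq, Real.dist_eq, zero_sub, abs_neg, abs_of_nonneg (hr n).1]
      exact (hr n).2
    have h3 : dist (v (r n)) (γ n (f n s)) ≤ dist (v (r n)) (v 0) + dist (v 0) (γ n (f n s)) :=
      dist_triangle _ _ _
    rw [dist_comm (v (r n)) (v 0)] at h3
    have h4 : max R₀ 0 + ℓ + 1 ≤ dist (v (r n)) (γ n (f n s)) := h1
    linarith [le_max_left R₀ 0]
  linarith

theorem Isometry.dist_real {v : ℝ → X} (hv : Isometry v) (s t : ℝ) :
    dist (v s) (v t) = |s - t| := by rw [hv.dist_eq, Real.dist_eq]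

/-- The distance from a point, restricted to a rank one axis, has slopes close to `±1` off an
interval of bounded length. -/
theorem IsRankOneAxis.not_small_slope [ProperSpace X] (hX : IsHadamard X) {g : X ≃ᵢ X} {v : ℝ → X}
    {ℓ : ℝ} (h : IsRankOneAxis g v ℓ) {ε : ℝ} (hε : 0 < ε) (hε1 : ε < 1) :
    ∃ L : ℝ, 0 < L ∧ ∀ (y : X) (a b : ℝ), a + L ≤ b → ¬ ∀ s ∈ Icc a b, ∀ t ∈ Icc a b,
      |dist y (v s) - dist y (v t)| ≤ (1 - ε) * |s - t| := by
  obtain ⟨R₁, hR1, hline⟩ := h.not_exists_segment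
  have hvd := Isometry.dist_real h.isometry
  -- The line is pushed a distance of order `r` towards `y`. The pushed curve `c` is 1-Lipschitz and
  -- stays within `2 * r` of `v`, so over a long interval some piece of it is almost isometric; the
  -- small slope keeps it `R₁` away from `v`, against `not_exists_segment`.
  set r : ℝ := 4 * R₁ / ε with hr
  have hrpos : 0 < r := by positivity
  obtain ⟨n, hn⟩ := hline (2 * r)
  set η : ℝ := 1 / ((n : ℝ) + 1) with hη
  have hηpos : 0 < η := by positivity
  obtain ⟨M, hM⟩ := exists_nat_ge (4 * r / η)
  have hMη : 4 * r ≤ M * η := by rwa [div_le_iff₀ hηpos] at hM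
  set W : ℝ := 2 * n * M with hW
  have hWpos : 0 ≤ W := by positivity
  refine ⟨2 * (r + 3 * W) + 1, by positivity, fun y a b hab hslope => ?_⟩
  -- On so long an interval one end is far from `y`; there the distance to `y` varies little in
  -- proportion over length `W`.
  obtain ⟨a', ha', hb', hf0⟩ : ∃ a', a ≤ a' ∧ a' + W ≤ b ∧ r + 2 * W ≤ dist y (v a') := by
    have h1 : b - a ≤ dist y (v a) + dist y (v b) := by
      have := dist_triangle (v a) y (v b)
      rw [hvd, abs_sub_comm, dist_comm _ y] at this
      linarith [le_abs_self (b - a)]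
    by_cases hc : r + 2 * W ≤ dist y (v a)
    · exact ⟨a, le_rfl, by linarith, hc⟩
    · refine ⟨b - W, by linarith, by linarith, ?_⟩
      have h2 := dist_triangle y (v (b - W)) (v b)
      rw [hvd, abs_sub_comm, sub_sub_cancel, abs_of_nonneg hWpos] at h2
      linarith
  set f₀ := dist y (v a') with hf0d
  have hf0pos : 0 < f₀ := by linarith
  set θ := r / f₀ with hθ
  have hθf : θ * f₀ = r := by rw [hθ]; field_simp
  have hθm : θ ∈ Icc (0 : ℝ) 1 := ⟨by positivity, by rw [hθ, div_le_one hf0pos]; linarith⟩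
  set c : ℝ → X := fun t => hX.pt (v t) y θ with hc
  have hcc : ∀ s t, dist (c s) (c t) ≤ |s - t| := by
    intro s t
    have := hX.dist_pt_pt_le (v s) y (v t) y hθm
    rw [dist_self, mul_zero, add_zero, hvd] at this
    exact this.trans (mul_le_of_le_one_left (abs_nonneg _) (by linarith [hθm.1]))
  have hcv : ∀ t, dist (c t) (v t) = θ * dist y (v t) := by
    intro t
    rw [dist_comm, hX.dist_left_pt _ _ hθm, dist_comm y]
  have hfbd : ∀ t ∈ Icc a' (a' + W), f₀ - W ≤ dist y (v t) ∧ dist y (v t) ≤ f₀ + W := by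
    intro t ht
    have h1 := dist_triangle y (v t) (v a')
    have h2 := dist_triangle y (v a') (v t)
    rw [hvd, abs_of_nonneg (by linarith [ht.1])] at h1
    rw [hvd, abs_sub_comm, abs_of_nonneg (by linarith [ht.1])] at h2
    constructor <;> linarith [ht.2]
  have hup : ∀ t ∈ Icc a' (a' + W), dist (c t) (v t) ≤ 2 * r := by
    intro t ht
    rw [hcv]
    have := mul_le_mul_of_nonneg_left (show dist y (v t) ≤ 2 * f₀ by linarith [(hfbd t ht).2]) hθm.1
    linarith
  -- If `c t` were close to `v t'`, going from `v t` to `v t'` would approach `y` at a speed close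
  -- to 1, more than the slope bound allows.
  have hlow : ∀ t ∈ Icc a' (a' + W), ∀ t' ∈ Icc a' (a' + W), R₁ ≤ dist (v t') (c t) := by
    intro t ht t' ht'
    have h1 := mul_le_mul_of_nonneg_left (show f₀ / 2 ≤ dist y (v t) by linarith [(hfbd t ht).1])
      hθm.1
    have h2 : dist y (v t') ≤ dist y (c t) + dist (v t') (c t) := by
      rw [dist_comm (v t')]; exact dist_triangle _ _ _
    have h3 : dist y (c t) = (1 - θ) * dist y (v t) := by
      rw [dist_comm, hX.dist_pt_right _ _ hθm, dist_comm y]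
    have h4 := (le_abs_self _).trans (hslope t ⟨by linarith [ht.1], by linarith [ht.2]⟩ t'
      ⟨by linarith [ht'.1], by linarith [ht'.2]⟩)
    have h5 : |t - t'| ≤ θ * dist y (v t) + dist (v t') (c t) := by
      rw [← hvd, ← hcv, dist_comm (c t) (v t), dist_comm (v t')]
      exact dist_triangle _ _ _
    have h6 := mul_le_mul_of_nonneg_left h5 (show 0 ≤ 1 - ε by linarith)
    have h7 : ε * (θ * dist y (v t)) ≤ 2 * dist (v t') (c t) := by
      have := mul_nonneg hε.le (dist_nonneg (x := v t') (y := c t))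
      linarith
    have h8 : ε * r = 4 * R₁ := by rw [hr]; field_simp
    have h9 := mul_le_mul_of_nonneg_left h1 hε.le
    have h10 : ε * (θ * (f₀ / 2)) = 2 * R₁ := by
      rw [show ε * (θ * (f₀ / 2)) = ε * (θ * f₀) / 2 by ring, hθf, h8]; ring
    linarith
  -- If all `M` pieces lost more than `η`, the total loss would exceed the `4 * r` permitted by the
  -- two ends of `c` being within `2 * r` of `v`.
  obtain ⟨i, hiM, hi⟩ : ∃ i < M, 2 * n - η ≤
      dist (c (a' + 2 * n * i)) (c (a' + 2 * n * (i + 1 : ℕ))) := by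
    by_contra! hcon
    have h1 := dist_le_range_sum_dist (fun i : ℕ => c (a' + 2 * n * i)) M
    have hMpos : 0 < M := by
      rcases Nat.eq_zero_or_pos M with h0 | h0
      · rw [h0] at hMη; norm_num at hMη; linarith
      · exact h0
    have h2 : ∑ i ∈ Finset.range M, dist (c (a' + 2 * n * i)) (c (a' + 2 * n * (i + 1 : ℕ))) <
        ∑ i ∈ Finset.range M, (2 * n - η) :=
      Finset.sum_lt_sum_of_nonempty ⟨0, by simpa using hMpos⟩
        fun i hi => hcon i (Finset.mem_range.1 hi)
    rw [Finset.sum_const, Finset.card_range, nsmul_eq_mul] at h2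
    have h3 : W ≤ dist (v a') (c a') + dist (c a') (c (a' + W)) + dist (c (a' + W)) (v (a' + W)) := by
      have h := dist_triangle4 (v a') (c a') (c (a' + W)) (v (a' + W))
      rw [hvd, abs_sub_comm, add_sub_cancel_left, abs_of_nonneg hWpos] at h
      exact h
    have h4 := hup a' ⟨le_rfl, by linarith⟩
    have h5 := hup (a' + W) ⟨by linarith, le_rfl⟩
    rw [dist_comm] at h4
    have h6 : dist (c a') (c (a' + W)) ≤
        ∑ i ∈ Finset.range M, dist (c (a' + 2 * n * i)) (c (a' + 2 * n * (i + 1 : ℕ))) := by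
      simpa [hW] using h1
    have h7 : (M : ℝ) * (2 * n - η) = W - M * η := by rw [hW]; ring
    linarith
  set m : ℝ := a' + 2 * n * i + n with hm
  have hend : a' + 2 * n * (i + 1 : ℕ) = m + n := by rw [hm]; push_cast; ring
  have hst : a' + 2 * n * i = m - n := by rw [hm]; ring
  rw [hend, hst] at hi
  have hma : a' ≤ m - n := by
    rw [← hst]
    have : (0 : ℝ) ≤ 2 * n * i := by positivity
    linarith
  have hmb : m + n ≤ a' + W := by
    rw [← hend, hW]
    have : (i + 1 : ℕ) ≤ (M : ℝ) := by exact_mod_cast hiM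
    have := mul_le_mul_of_nonneg_left this (show (0 : ℝ) ≤ 2 * n by positivity)
    linarith
  have hmem : ∀ t : ℝ, |t| ≤ n → m + t ∈ Icc a' (a' + W) := fun t ht => by
    rw [abs_le] at ht
    constructor <;> linarith
  have hdef : ∀ s t : ℝ, |s| ≤ n → |t| ≤ n → s ≤ t →
      |s - t| - η ≤ dist (c (m + s)) (c (m + t)) := by
    intro s t hs ht hst
    rw [abs_le] at hs ht
    have h1 := dist_triangle4 (c (m - n)) (c (m + s)) (c (m + t)) (c (m + n))
    have h2 := hcc (m - n) (m + s)
    have h3 := hcc (m + t) (m + n)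
    rw [abs_of_nonpos (by linarith)] at h2 h3
    rw [abs_of_nonpos (by linarith)]
    linarith
  refine hn m ⟨fun t => c (m + t), fun s t hs ht => ?_, fun t ht => ⟨?_, ?_⟩⟩
  · have h1 := hcc (m + s) (m + t)
    rw [add_sub_add_left_eq_sub] at h1
    have h2 : |s - t| - η ≤ dist (c (m + s)) (c (m + t)) := by
      rcases le_total s t with hle | hle
      · exact hdef s t hs ht hle
      · rw [abs_sub_comm, dist_comm]; exact hdef t s ht hs hle
    rw [abs_le]; constructor <;> linarith
  · exact hup _ (hmem t ht)
  · exact hlow _ (hmem t ht) m (by simpa using hmem 0 (by simp))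

/-! ### Rank one axes are contracting -/

namespace IsHadamard

variable (hX : IsHadamard X)
include hX

theorem continuousOn_pt (x y : X) : ContinuousOn (hX.pt x y) (Icc 0 1) := by
  refine (LipschitzOnWith.of_dist_le_mul (K := ⟨dist x y, dist_nonneg⟩)
    fun s hs t ht => ?_).continuousOn
  rw [hX.dist_pt_pt x y hs ht, Real.dist_eq, mul_comm]
  rfl

theorem infDist_segment_le (z x y x' y' : X) :
    Metric.infDist z (hX.pt x y '' Icc 0 1) ≤
      Metric.infDist z (hX.pt x' y' '' Icc 0 1) + (dist x x' + dist y y') := by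
  rw [← sub_le_iff_le_add, Metric.le_infDist
    ⟨_, mem_image_of_mem _ (by simp : (0 : ℝ) ∈ Icc (0 : ℝ) 1)⟩]
  rintro _ ⟨s, hs, rfl⟩
  have h1 := Metric.infDist_le_dist_of_mem (x := z) (mem_image_of_mem (hX.pt x y) hs)
  have h2 := hX.dist_pt_pt_le x y x' y' hs
  have h3 := mul_le_of_le_one_left (dist_nonneg (x := x) (y := x')) (show 1 - s ≤ 1 by linarith [hs.1])
  have h4 := mul_le_of_le_one_left (dist_nonneg (x := y) (y := y')) hs.2
  have h5 := dist_triangle z (hX.pt x' y' s) (hX.pt x y s)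
  rw [dist_comm (hX.pt x' y' s)] at h5
  linarith

/-- If moving from `o` to `q` approaches `x` almost at unit speed, then `q` lies almost in the
direction of `x`. In `dist_pt_sq_le` everything cancels except at most `2 * e * k ^ 2`, which is 1
for the defect `e = 1 / (2 * k ^ 2)`. -/
theorem dist_pt_le_one_of_slope {o q x : X} {k : ℝ} (hk : 1 ≤ k) (hoq : dist o q = k)
    (hD : k ≤ dist o x) (hx : dist x q ≤ dist o x - (1 - 1 / (2 * k ^ 2)) * k) :
    dist (hX.pt o x (k / dist o x)) q ≤ 1 := by
  have hDpos : 0 < dist o x := by linarith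
  have hκ : k / dist o x ∈ Icc (0 : ℝ) 1 := ⟨by positivity, (div_le_one hDpos).2 hD⟩
  have h1 := hX.dist_pt_sq_le o x q hκ
  have h2 := pow_le_pow_left₀ dist_nonneg hx 2
  have h3 := mul_le_mul_of_nonneg_left h2 hκ.1
  rw [hoq] at h1
  set D := dist o x with hDdef
  set κ := k / D with hκd
  have hkD : κ * D = k := by rw [hκd]; field_simp
  set e := 1 / (2 * k ^ 2) with he
  have hek : 2 * e * k ^ 2 = 1 := by rw [he]; field_simp
  have he1 : e ≤ 1 := by
    rw [he, div_le_one (by positivity)]; nlinarith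
  have he0 : 0 ≤ e := by positivity
  have h4 : κ * (D - (1 - e) * k) ^ 2 = D * k - 2 * (1 - e) * k ^ 2 + κ * ((1 - e) ^ 2 * k ^ 2) := by
    have : κ * (D - (1 - e) * k) ^ 2 =
        D * (κ * D) - 2 * (1 - e) * k * (κ * D) + κ * ((1 - e) ^ 2 * k ^ 2) := by ring
    rw [this, hkD]; ring
  have h5 : κ * (1 - κ) * D ^ 2 = k * D - k ^ 2 := by
    have : κ * (1 - κ) * D ^ 2 = (κ * D) * D - (κ * D) ^ 2 := by ring
    rw [this, hkD]
  have h6 : κ * ((1 - e) ^ 2 * k ^ 2) ≤ κ * k ^ 2 := by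
    refine mul_le_mul_of_nonneg_left (mul_le_of_le_one_left (by positivity) ?_) hκ.1
    exact pow_le_one₀ (by linarith) (by linarith)
  have h7 : dist (hX.pt o x κ) q ^ 2 ≤ 1 := by
    rw [h4] at h3
    rw [h5] at h1
    linarith
  exact (sq_le_one_iff₀ dist_nonneg).1 h7

theorem dist_pt_div_pt_div_le {o q x b : X} {k t : ℝ} (hk : 0 < k) (hD : k ≤ dist o x)
    (hb : dist (hX.pt o x (k / dist o x)) b ≤ 1) (ht : 0 ≤ t) (htk : t ≤ k)
    (hα : 0 < dist q x) (htα : t ≤ dist q x) :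
    dist (hX.pt q x (t / dist q x)) (hX.pt o b (t / k)) ≤ 2 * dist o q + 1 := by
  have hDpos : 0 < dist o x := by linarith
  have h1 : t / k ∈ Icc (0 : ℝ) 1 := ⟨by positivity, (div_le_one hk).2 htk⟩
  have h2 : k / dist o x ∈ Icc (0 : ℝ) 1 := ⟨by positivity, (div_le_one hDpos).2 hD⟩
  have h3 : t / dist o x ∈ Icc (0 : ℝ) 1 := ⟨by positivity, (div_le_one hDpos).2 (htk.trans hD)⟩
  have h4 : t / dist q x ∈ Icc (0 : ℝ) 1 := ⟨by positivity, (div_le_one hα).2 htα⟩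
  have e1 : hX.pt o x (t / dist o x) = hX.pt o (hX.pt o x (k / dist o x)) (t / k) := by
    rw [hX.pt_pt_left _ _ h2 h1]; congr 1; field_simp
  have d1 : dist (hX.pt o x (t / dist o x)) (hX.pt o b (t / k)) ≤ 1 := by
    rw [e1]
    refine (hX.dist_pt_pt_same_left _ _ _ h1).trans ?_
    exact mul_le_one₀ h1.2 dist_nonneg hb
  have d2 : dist (hX.pt q x (t / dist o x)) (hX.pt o x (t / dist o x)) ≤ dist o q := by
    have := hX.dist_pt_pt_le q x o x h3
    rw [dist_self, mul_zero, add_zero, dist_comm q] at this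
    exact this.trans (mul_le_of_le_one_left dist_nonneg (by linarith [h3.1]))
  have d3 : dist (hX.pt q x (t / dist q x)) (hX.pt q x (t / dist o x)) ≤ dist o q := by
    rw [hX.dist_pt_pt _ _ h4 h3]
    have : t / dist q x - t / dist o x =
        (t / dist o x) * ((dist o x - dist q x) / dist q x) := by field_simp
    rw [this, abs_mul, abs_of_nonneg h3.1, abs_div, abs_of_pos hα, mul_assoc,
      div_mul_cancel₀ _ hα.ne']
    refine (mul_le_of_le_one_left (abs_nonneg _) h3.2).trans ?_
    exact abs_dist_sub_le _ _ _
  linarith [dist_triangle4 (hX.pt q x (t / dist q x)) (hX.pt q x (t / dist o x))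
    (hX.pt o x (t / dist o x)) (hX.pt o b (t / k))]

theorem convexOn_dist_line {v : ℝ → X} (hv : Isometry v) (x : X) :
    ConvexOn ℝ univ fun t => dist x (v t) := by
  refine ⟨convex_univ, fun a _ b _ s t hs ht hst => ?_⟩
  have ht1 : t ∈ Icc (0 : ℝ) 1 := ⟨ht, by linarith⟩
  have h := hX.dist_pt_point_le (v a) (v b) x ht1
  rw [hX.pt_line hv a b ht1] at h
  obtain rfl : s = 1 - t := by linarith
  simp only [smul_eq_mul]
  rwa [show (1 - t) * a + t * b = a + t * (b - a) by ring]

end IsHadamard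

/-- Slopes of a convex function increase: a slope below `c` on `[s - r, s]` would bound all slopes
on `[t₀, t₀ + L]`, and these are nonnegative to the right of a minimum. -/
theorem convex_slope_of_not_small {f : ℝ → ℝ} (hf : ConvexOn ℝ univ f) {t₀ L r c s : ℝ}
    (hmin : ∀ t, f t₀ ≤ f t) (hr : 0 < r)
    (hbad : ¬ ∀ u ∈ Icc t₀ (t₀ + L), ∀ u' ∈ Icc t₀ (t₀ + L), |f u - f u'| ≤ c * |u - u'|)
    (hs : t₀ + L + r ≤ s) : f (s - r) ≤ f s - c * r := by
  by_contra! hcon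
  apply hbad
  have key : ∀ u ∈ Icc t₀ (t₀ + L), ∀ u' ∈ Icc t₀ (t₀ + L), u < u' →
      |f u - f u'| ≤ c * |u - u'| := by
    intro u hu u' hu' huu
    have hmono : f u ≤ f u' := by
      rcases hu.1.eq_or_lt with h0 | h0
      · rw [← h0]; exact hmin _
      · have h := hf.slope_mono_adjacent (mem_univ t₀) (mem_univ u') h0 huu
        have h' : 0 ≤ (f u - f t₀) / (u - t₀) :=
          div_nonneg (by linarith [hmin u]) (by linarith)
        have h'' := h'.trans h
        rw [le_div_iff₀ (by linarith)] at h''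
        linarith
    rw [abs_of_nonpos (by linarith), abs_of_nonpos (by linarith)]
    have h1 := hf.slope_mono_adjacent (mem_univ u) (mem_univ s) huu
      (show u' < s by linarith [hu'.2])
    have h2 : (f s - f u') / (s - u') ≤ (f s - f (s - r)) / r := by
      rcases (show u' ≤ s - r by linarith [hu'.2]).eq_or_lt with h0 | h0
      · rw [h0, sub_sub_cancel]
      · have h := hf.secant_mono_aux3 (mem_univ u') (mem_univ s) h0 (show s - r < s by linarith)
        rwa [sub_sub_cancel] at h
    have h3 : (f s - f (s - r)) / r < c := by rw [div_lt_iff₀ hr]; linarith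
    have h4 := (h1.trans h2).trans h3.le
    rw [div_le_iff₀ (by linarith)] at h4
    linarith
  intro u hu u' hu'
  rcases lt_trichotomy u u' with h | h | h
  · exact key u hu u' hu' h
  · simp [h]
  · rw [abs_sub_comm, abs_sub_comm u]; exact key u' hu' u hu h

/-- Geodesics between points which lie far out on both sides of `v a` pass near `v a`. -/
theorem IsRankOneAxis.exists_pt_near [ProperSpace X] (hX : IsHadamard X) {g : X ≃ᵢ X} {v : ℝ → X}
    {ℓ : ℝ} (h : IsRankOneAxis g v ℓ) :
    ∃ R r ε : ℝ, 0 < r ∧ 0 < ε ∧ ε < 1 ∧ ∀ (x y : X) (a : ℝ),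
      dist x (v (a - r)) ≤ dist x (v a) - (1 - ε) * r →
      dist y (v (a + r)) ≤ dist y (v a) - (1 - ε) * r →
      ∃ θ ∈ Icc (0 : ℝ) 1, dist (hX.pt x y θ) (v a) ≤ R := by
  obtain ⟨R₁, hR1, hline⟩ := h.not_exists_segment
  obtain ⟨n, hn⟩ := hline (2 * R₁ + 1)
  have hvd := Isometry.dist_real h.isometry
  -- A point at distance `R₁` from `v a` is then at distance at least `n + 1` from points at
  -- distance at least `k`. The hypotheses are used at distance `2 * k`: this forces `x` and `y` to
  -- be at least `k` away, and convexity passes the slope on to distance `k`.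
  set k : ℝ := n + R₁ + 1 with hk
  have hn0 : (0 : ℝ) ≤ n := n.cast_nonneg
  have hk1 : 1 ≤ k := by linarith
  have hkpos : 0 < k := by linarith
  have he1 : 1 / (2 * k ^ 2) ≤ 1 / 2 :=
    one_div_le_one_div_of_le (by norm_num) (by nlinarith)
  refine ⟨R₁, 2 * k, 1 / (2 * k ^ 2), by linarith, by positivity, by linarith,
    fun x y a hx hy => ?_⟩
  have hside : ∀ (z : X) (σ : ℝ), |σ| = 1 →
      dist z (v (a + σ * (2 * k))) ≤ dist z (v a) - (1 - 1 / (2 * k ^ 2)) * (2 * k) →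
      k ≤ dist (v a) z ∧
        dist (hX.pt (v a) z (k / dist (v a) z)) (v (a + σ * k)) ≤ 1 := by
    intro z σ hσ hz
    have h1 : k ≤ dist (v a) z := by
      have := dist_nonneg (x := z) (y := v (a + σ * (2 * k)))
      rw [dist_comm]
      nlinarith
    refine ⟨h1, hX.dist_pt_le_one_of_slope hk1 ?_ h1 ?_⟩
    · rw [hvd, sub_add_cancel_left, abs_neg, abs_mul, hσ, abs_of_pos hkpos, one_mul]
    · have h2 := hX.dist_pt_point_le (v a) (v (a + σ * (2 * k))) z (s := 1 / 2) (by norm_num)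
      rw [hX.pt_line h.isometry _ _ (by norm_num)] at h2
      rw [show a + 1 / 2 * (a + σ * (2 * k) - a) = a + σ * k by ring] at h2
      rw [dist_comm (v a) z]
      linarith
  obtain ⟨hxk, hxp⟩ := hside x (-1) (by simp) (by simpa [sub_eq_add_neg] using hx)
  obtain ⟨hyk, hyp⟩ := hside y 1 (by simp) (by simpa using hy)
  set o := v a with ho
  have hxpos : 0 < dist o x := by linarith
  have hypos : 0 < dist o y := by linarith
  by_contra! hfar
  -- the points of `[o, z]` from distance `k` on
  set Z : X → ℝ → X := fun z s => hX.pt o z (k / dist o z + s * (1 - k / dist o z)) with hZ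
  have hZm : ∀ z, k ≤ dist o z → ∀ s ∈ Icc (0 : ℝ) 1,
      k / dist o z + s * (1 - k / dist o z) ∈ Icc (0 : ℝ) 1 := by
    intro z hz s hs
    have hzp : 0 < dist o z := by linarith
    have h1 : k / dist o z ≤ 1 := (div_le_one hzp).2 hz
    have h0 : 0 ≤ k / dist o z := by positivity
    constructor
    · have := mul_nonneg hs.1 (show 0 ≤ 1 - k / dist o z by linarith); linarith
    · have := mul_le_of_le_one_left (show 0 ≤ 1 - k / dist o z by linarith) hs.2; linarith
  have hZlip : ∀ z, k ≤ dist o z → ∀ s ∈ Icc (0 : ℝ) 1, ∀ t ∈ Icc (0 : ℝ) 1,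
      dist (Z z s) (Z z t) ≤ dist o z * |s - t| := by
    intro z hz s hs t ht
    have hzp : 0 < dist o z := by linarith
    have h1 : k / dist o z ≤ 1 := (div_le_one hzp).2 hz
    have h0 : 0 ≤ k / dist o z := by positivity
    simp only [hZ]
    rw [hX.dist_pt_pt _ _ (hZm z hz s hs) (hZm z hz t ht), add_sub_add_left_eq_sub, ← sub_mul,
      abs_mul, abs_of_nonneg (show 0 ≤ 1 - k / dist o z by linarith), mul_comm]
    refine mul_le_mul_of_nonneg_left ?_ hzp.le
    exact mul_le_of_le_one_right (abs_nonneg _) (by linarith)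
  have hZk : ∀ z, k ≤ dist o z → ∀ s ∈ Icc (0 : ℝ) 1, k ≤ dist o (Z z s) ∧
      hX.pt o (Z z s) (k / dist o (Z z s)) = hX.pt o z (k / dist o z) := by
    intro z hz s hs
    have hzp : 0 < dist o z := by linarith
    have h1 : k / dist o z ≤ 1 := (div_le_one hzp).2 hz
    have hm := hZm z hz s hs
    have hd : dist o (Z z s) = (k / dist o z + s * (1 - k / dist o z)) * dist o z :=
      hX.dist_left_pt _ _ hm
    have hle : k ≤ dist o (Z z s) := by
      rw [hd, add_mul, div_mul_cancel₀ _ hzp.ne']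
      have := mul_nonneg (mul_nonneg hs.1 (show 0 ≤ 1 - k / dist o z by linarith)) hzp.le
      linarith
    refine ⟨hle, ?_⟩
    have hpos : 0 < dist o (Z z s) := by linarith
    have hm' : k / dist o (Z z s) ∈ Icc (0 : ℝ) 1 := ⟨by positivity, (div_le_one hpos).2 hle⟩
    have : hX.pt o (Z z s) (k / dist o (Z z s)) =
        hX.pt o z (k / dist o (Z z s) * (k / dist o z + s * (1 - k / dist o z))) :=
      hX.pt_pt_left _ _ hm hm'
    rw [this]
    congr 1
    have hne : k / dist o z + s * (1 - k / dist o z) ≠ 0 := by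
      intro h0; rw [h0, zero_mul] at hd; linarith
    rw [hd, div_mul_eq_mul_div, mul_comm k, mul_div_mul_left _ _ hne]
  -- The endpoints slide outwards along `[o, x]` and `[o, y]`. At `s = 0` the segment passes within
  -- `1 ≤ R₁` of `o`, at `s = 1` it misses the ball of radius `R₁`, so some intermediate segment is
  -- at distance exactly `R₁`.
  set φ : ℝ → ℝ := fun s => Metric.infDist o (hX.pt (Z x s) (Z y s) '' Icc 0 1) with hφ
  have hφc : ContinuousOn φ (Icc 0 1) := by
    refine (LipschitzOnWith.of_le_add_mul ⟨dist o x + dist o y, by positivity⟩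
      fun s hs t ht => ?_).continuousOn
    have h1 := hX.infDist_segment_le o (Z x s) (Z y s) (Z x t) (Z y t)
    have h2 := hZlip x hxk s hs t ht
    have h3 := hZlip y hyk s hs t ht
    rw [Real.dist_eq]
    change φ s ≤ φ t + (dist o x + dist o y) * |s - t|
    simp only [hφ]
    linarith
  have h01 : (1 : ℝ) / 2 ∈ Icc (0 : ℝ) 1 := by norm_num
  have hφ0 : φ 0 ≤ R₁ := by
    have h1 := Metric.infDist_le_dist_of_mem (x := o)
      (mem_image_of_mem (hX.pt (Z x 0) (Z y 0)) h01)
    have h2 := hX.dist_pt_pt_le (Z x 0) (Z y 0) (v (a + -1 * k)) (v (a + 1 * k)) h01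
    rw [hX.pt_line h.isometry _ _ h01,
      show a + -1 * k + 1 / 2 * (a + 1 * k - (a + -1 * k)) = a by ring, dist_comm] at h2
    have h3 : dist (Z x 0) (v (a + -1 * k)) ≤ 1 := by simpa [hZ] using hxp
    have h4 : dist (Z y 0) (v (a + 1 * k)) ≤ 1 := by simpa [hZ] using hyp
    have h5 : φ 0 ≤ dist o (hX.pt (Z x 0) (Z y 0) (1 / 2)) := h1
    linarith
  have hφ1 : R₁ ≤ φ 1 := by
    refine (Metric.le_infDist ⟨_, mem_image_of_mem _ h01⟩).2 ?_
    rintro _ ⟨θ, hθ, rfl⟩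
    have := hfar θ hθ
    rw [dist_comm]
    simpa [hZ] using this.le
  obtain ⟨s, hs, hφs⟩ := intermediate_value_Icc zero_le_one hφc ⟨hφ0, hφ1⟩
  set x' := Z x s with hx'
  set y' := Z y s with hy'
  obtain ⟨hx'k, hx'p⟩ := hZk x hxk s hs
  obtain ⟨hy'k, hy'p⟩ := hZk y hyk s hs
  rw [← hx'p] at hxp
  rw [← hy'p] at hyp
  obtain ⟨q, ⟨τ, hτ, rfl⟩, hq⟩ := (isCompact_Icc.image_of_continuousOn
    (hX.continuousOn_pt x' y')).exists_infDist_eq_dist ⟨_, mem_image_of_mem _ h01⟩ o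
  have hoq : dist o (hX.pt x' y' τ) = R₁ := by rw [← hq]; exact hφs
  have hge : ∀ θ ∈ Icc (0 : ℝ) 1, R₁ ≤ dist o (hX.pt x' y' θ) := fun θ hθ => by
    rw [← hφs]; exact Metric.infDist_le_dist_of_mem (mem_image_of_mem _ hθ)
  set q := hX.pt x' y' τ with hqd
  set E := dist x' y' with hE
  have hα : dist q x' = τ * E := by rw [dist_comm]; exact hX.dist_left_pt _ _ hτ
  have hβ : dist q y' = (1 - τ) * E := hX.dist_pt_right _ _ hτ
  have hαn : (n : ℝ) + 1 ≤ dist q x' := by linarith [dist_triangle o q x']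
  have hβn : (n : ℝ) + 1 ≤ dist q y' := by linarith [dist_triangle o q y']
  have hEpos : 0 < E := by nlinarith
  have hfm : ∀ t : ℝ, |t| ≤ n → τ + t / E ∈ Icc (0 : ℝ) 1 := by
    intro t ht
    rw [abs_le] at ht
    have : τ + t / E = (τ * E + t) / E := by field_simp
    rw [this]
    constructor
    · exact div_nonneg (by linarith) hEpos.le
    · rw [div_le_one hEpos]; linarith
  -- Parametrized by arc length from its point `q` nearest to `o`, this segment follows `v` for
  -- length `n` on both sides, yet stays outside the `R₁`-ball.
  refine hn a ⟨fun t => hX.pt x' y' (τ + t / E), fun s t hs ht => ?_, fun t ht => ⟨?_, ?_⟩⟩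
  · rw [hX.dist_pt_pt _ _ (hfm s hs) (hfm t ht), add_sub_add_left_eq_sub, ← sub_div, abs_div,
      abs_of_pos hEpos, div_mul_cancel₀ _ hEpos.ne', sub_self, abs_zero]
    positivity
  · have hline' : ∀ (z : X) (σ u : ℝ), 0 ≤ u → u ≤ n → n + 1 ≤ dist q z → k ≤ dist o z →
        dist (hX.pt o z (k / dist o z)) (v (a + σ * k)) ≤ 1 →
        dist (hX.pt q z (u / dist q z)) (v (a + σ * u)) ≤ 2 * R₁ + 1 := by
      intro z σ u hu hun hqz hoz hz
      have := hX.dist_pt_div_pt_div_le hkpos hoz hz hu (by linarith) (by linarith)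
        (show u ≤ dist q z by linarith)
      rw [hX.pt_line h.isometry _ _ ⟨by positivity, (div_le_one hkpos).2 (by linarith)⟩, hoq]
        at this
      rwa [show a + u / k * (a + σ * k - a) = a + σ * u by field_simp; ring] at this
    rw [abs_le] at ht
    have hft := hfm t (abs_le.2 ht)
    have hqf : dist q (hX.pt x' y' (τ + t / E)) = |t| := by
      rw [hX.dist_pt_pt _ _ hτ hft, sub_add_cancel_left, abs_neg, abs_div, abs_of_pos hEpos,
        div_mul_cancel₀ _ hEpos.ne']
    rcases le_total t 0 with h0 | h0
    · have h1 := hline' x' (-1) (-t) (by linarith) (by linarith) hαn hx'k hxp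
      rw [show a + -1 * -t = a + t by ring] at h1
      have hαpos : 0 < dist q x' := by linarith
      rwa [← hX.eq_pt (z := hX.pt x' y' (τ + t / E)) (s := -t / dist q x')
        ⟨div_nonneg (by linarith) hαpos.le, (div_le_one hαpos).2 (by linarith)⟩] at h1
      · rw [hqf, abs_of_nonpos h0]; field_simp
      · rw [dist_comm, hX.dist_left_pt _ _ hft, sub_mul, one_mul, div_mul_cancel₀ _ hαpos.ne', hα]
        field_simp
        ring
    · have h1 := hline' y' 1 t (by linarith) (by linarith) hβn hy'k hyp
      rw [one_mul] at h1
      have hβpos : 0 < dist q y' := by linarith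
      rwa [← hX.eq_pt (z := hX.pt x' y' (τ + t / E)) (s := t / dist q y')
        ⟨div_nonneg (by linarith) hβpos.le, (div_le_one hβpos).2 (by linarith)⟩] at h1
      · rw [hqf, abs_of_nonneg h0]; field_simp
      · rw [hX.dist_pt_right _ _ hft, ← hE, sub_mul 1 (t / dist q y'), one_mul,
          div_mul_cancel₀ _ hβpos.ne', hβ]
        field_simp
        ring
  · exact hge _ (hfm t ht)

/-- Geodesics between points with distant projections to the line `w` pass at distance at most `R`
of the points of `w` between these projections. -/
def IsContracting (hX : IsHadamard X) (w : ℝ → X) (L R : ℝ) : Prop :=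
  ∀ (x y : X) (t₀ t₁ s : ℝ), Near w x t₀ → Near w y t₁ → t₀ + L ≤ s → s + L ≤ t₁ →
    ∃ θ ∈ Icc (0 : ℝ) 1, dist (hX.pt x y θ) (w s) ≤ R

theorem IsRankOneAxis.isContracting [ProperSpace X] (hX : IsHadamard X) {g : X ≃ᵢ X} {v : ℝ → X}
    {ℓ : ℝ} (h : IsRankOneAxis g v ℓ) : ∃ L R, IsContracting hX v L R := by
  obtain ⟨R, r, ε, hr, hε, hε1, hR⟩ := h.exists_pt_near hX
  obtain ⟨L, hL, hslope⟩ := h.not_small_slope hX hε hε1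
  refine ⟨L + r, R, fun x y t₀ t₁ s hx hy h0 h1 => hR x y s ?_ ?_⟩
  · exact convex_slope_of_not_small (hX.convexOn_dist_line h.isometry x) hx hr
      (hslope x t₀ (t₀ + L) le_rfl) (by linarith)
  -- The other side follows by reversing the line.
  · have hconv : ConvexOn ℝ univ fun t => dist y (v (-t)) := by
      refine hX.convexOn_dist_line (v := fun t => v (-t)) ?_ y
      exact h.isometry.comp (IsometryEquiv.neg ℝ).isometry
    have := convex_slope_of_not_small (f := fun t => dist y (v (-t))) hconv (t₀ := -t₁) (L := L)
      (c := 1 - ε) (s := -s) (fun t => by simpa using hy (-t)) hr ?_ (by linarith)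
    · simpa [add_comm] using this
    · intro hc
      refine hslope y (t₁ - L) t₁ (by linarith) fun u hu u' hu' => ?_
      have := hc (-u) ⟨by linarith [hu.2], by linarith [hu.1]⟩ (-u')
        ⟨by linarith [hu'.2], by linarith [hu'.1]⟩
      simp only [neg_neg] at this
      rwa [show -u - -u' = -(u - u') by ring, abs_neg] at this

/-! ### Rays, the cone topology and limit sets -/

theorem IsHadamard.pt_div_pt (hX : IsHadamard X) (o x : X) {θ r : ℝ} (hθ : θ ∈ Icc (0 : ℝ) 1)
    (hr : 0 ≤ r) (h : r ≤ dist o (hX.pt o x θ)) (h0 : 0 < dist o (hX.pt o x θ)) :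
    hX.pt o (hX.pt o x θ) (r / dist o (hX.pt o x θ)) = hX.pt o x (r / dist o x) := by
  rw [hX.pt_pt_left _ _ hθ ⟨by positivity, (div_le_one h0).2 h⟩]
  rw [hX.dist_left_pt _ _ hθ] at h0 ⊢
  have h1 : θ ≠ 0 := fun h => by simp [h] at h0
  congr 1
  rw [div_mul_eq_mul_div, mul_comm r, mul_div_mul_left _ _ h1]

theorem IsHadamard.segment_eq_pt (hX : IsHadamard X) {σ : ℝ → X} {x y : X}
    (hσ : IsGeodesicSegment σ x y) {r : ℝ} (hr : 0 ≤ r) (hrd : r ≤ dist x y) (h0 : 0 < dist x y) :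
    σ r = hX.pt x y (r / dist x y) := by
  refine hX.eq_pt ⟨by positivity, (div_le_one h0).2 hrd⟩ ?_ ?_
  · rw [← hσ.1]
    have := hσ.2.2 0 ⟨le_rfl, h0.le⟩ r ⟨hr, hrd⟩
    rw [this, hσ.1, div_mul_cancel₀ _ h0.ne', zero_sub, abs_neg, abs_of_nonneg hr]
  · have := hσ.2.2 r ⟨hr, hrd⟩ (dist x y) ⟨h0.le, le_rfl⟩
    rw [hσ.2.1] at this
    rw [this, sub_mul, div_mul_cancel₀ _ h0.ne', abs_of_nonpos (by linarith)]
    ring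

theorem IsHadamard.pt_ray_div (hX : IsHadamard X) (σ : GeodesicRay X) {r s : ℝ≥0} (hs : 0 < s)
    (hrs : r ≤ s) : hX.pt (σ 0) (σ s) (r / s) = σ r := by
  have := hX.pt_ray σ s (s := r / s) (div_le_one_of_le₀ hrs s.2)
  rw [div_mul_cancel₀ _ hs.ne'] at this
  rw [← this, NNReal.coe_div]

/-- In a proper Hadamard space every boundary point is represented by a ray from `o`. -/
theorem IsHadamard.exists_ray [ProperSpace X] (hX : IsHadamard X) (o : X) (σ : GeodesicRay X) :
    ∃ ρ : GeodesicRay X, ρ 0 = o ∧ Asymptotic ρ σ := by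
  set e := dist o (σ 0) with he
  set D : ℕ → ℝ := fun n => dist o (σ n) with hD
  have hDn : ∀ n : ℕ, |(n : ℝ) - D n| ≤ e := by
    intro n
    have h1 := σ.dist_zero n
    rw [NNReal.coe_natCast] at h1
    rw [← h1, abs_sub_comm]
    exact abs_dist_sub_le _ _ _
  set f : ℕ → ℝ≥0 → X := fun n t => hX.pt o (σ n) (t / D n) with hf
  have hev : ∀ t : ℝ≥0, ∀ᶠ n : ℕ in atTop, (0 < n ∧ t ≤ n) ∧ (0 < D n ∧ (t : ℝ) ≤ D n) := by
    intro t
    filter_upwards [(tendsto_natCast_atTop_atTop (R := ℝ)).eventually_ge_atTop (t + e + 1),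
      eventually_gt_atTop 0] with n hn hn0
    have h1 := abs_le.1 (hDn n)
    have h2 : 0 ≤ e := dist_nonneg
    have h3 := t.2
    refine ⟨⟨hn0, ?_⟩, ?_, ?_⟩
    · have : (t : ℝ) ≤ n := by linarith
      exact_mod_cast this
    · change (0 : ℝ) ≤ t at h3; linarith
    · linarith
  have hclose : ∀ t : ℝ≥0, ∀ᶠ n : ℕ in atTop, dist (f n t) (σ t) ≤ 2 * e := by
    intro t
    filter_upwards [hev t] with n hn
    obtain ⟨⟨hn0, htn⟩, hDpos, htD⟩ := hn
    have hn0' : (0 : ℝ) < n := by exact_mod_cast hn0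
    have htn' : (t : ℝ) ≤ n := by exact_mod_cast htn
    have m1 : (t : ℝ) / D n ∈ Icc (0 : ℝ) 1 := ⟨by positivity, (div_le_one hDpos).2 htD⟩
    have m2 : (t : ℝ) / n ∈ Icc (0 : ℝ) 1 := ⟨by positivity, (div_le_one hn0').2 htn'⟩
    have h1 : hX.pt (σ 0) (σ n) (t / n) = σ t := by
      have := hX.pt_ray_div σ (show (0 : ℝ≥0) < n by exact_mod_cast hn0) htn
      rwa [NNReal.coe_natCast] at this
    have h2 := hX.dist_pt_pt_le o (σ n) (σ 0) (σ n) m2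
    rw [dist_self, mul_zero, add_zero, h1] at h2
    have h3 : dist (f n t) (hX.pt o (σ n) (t / n)) ≤ e := by
      simp only [hf]
      rw [hX.dist_pt_pt _ _ m1 m2]
      change |t / D n - t / n| * D n ≤ e
      have : (t : ℝ) / D n - t / n = (t / n) * ((n - D n) / D n) := by field_simp
      rw [this, abs_mul, abs_of_nonneg m2.1, abs_div, abs_of_pos hDpos, mul_assoc,
        div_mul_cancel₀ _ hDpos.ne']
      exact (mul_le_of_le_one_left (abs_nonneg _) m2.2).trans (hDn n)
    have h4 := mul_le_of_le_one_left (show 0 ≤ e from dist_nonneg)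
      (show 1 - (t : ℝ) / n ≤ 1 by linarith [m2.1])
    linarith [dist_triangle (f n t) (hX.pt o (σ n) (t / n)) (σ t)]
  -- The ray is the limit of the segments from `o` to `σ n`.
  choose ρ hρ using fun t => exists_tendsto_hyperfilter (hclose t)
  have hiso : Isometry ρ := by
    refine Isometry.of_dist_eq fun s t => ?_
    refine tendsto_nhds_unique ((hρ s).dist (hρ t)) (tendsto_const_nhds.congr' ?_)
    refine Nat.hyperfilter_le_atTop ?_
    filter_upwards [hev s, hev t] with n hs ht
    have hDpos := hs.2.1
    simp only [hf]
    rw [hX.dist_pt_pt _ _ ⟨by positivity, (div_le_one hDpos).2 hs.2.2⟩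
      ⟨by positivity, (div_le_one hDpos).2 ht.2.2⟩, ← sub_div, abs_div, abs_of_pos hDpos,
      div_mul_cancel₀ _ hDpos.ne', NNReal.dist_eq]
  refine ⟨⟨ρ, hiso⟩, ?_, 2 * e, fun t => ?_⟩
  · refine tendsto_nhds_unique (hρ 0) (tendsto_const_nhds.congr fun n => ?_)
    simp [hf]
  · exact le_of_tendsto ((hρ t).dist tendsto_const_nhds) (Nat.hyperfilter_le_atTop (hclose t))

/-- Points near a ray at large distance from its origin are close to its end point. -/
theorem IsHadamard.ofPoint_mem_of_isOpen (hX : IsHadamard X) (ρ : GeodesicRay X) {C : ℝ}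
    (hC : 0 ≤ C) {W : Set (Bordification X)} (hW : IsOpen W) (hρW : ofBoundary ρ.endpoint ∈ W) :
    ∃ r₀ : ℝ≥0, 0 < r₀ ∧ ∀ r ≥ r₀, ∀ x : X, (r : ℝ) < dist (ρ 0) x →
      dist (hX.pt (ρ 0) x (r / dist (ρ 0) x)) (ρ r) ≤ C → ofPoint x ∈ W := by
  induction hW with
  | univ => exact ⟨1, one_pos, fun _ _ _ _ _ => mem_univ _⟩
  | inter U V _ _ hU hV =>
    obtain ⟨r₁, h1, hr1⟩ := hU hρW.1
    obtain ⟨r₂, h2, hr2⟩ := hV hρW.2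
    exact ⟨max r₁ r₂, lt_max_of_lt_left h1, fun r hr x hx hd =>
      ⟨hr1 r ((le_max_left _ _).trans hr) x hx hd, hr2 r ((le_max_right _ _).trans hr) x hx hd⟩⟩
  | sUnion S _ hS =>
    obtain ⟨U, hU, hmem⟩ := hρW
    obtain ⟨r₀, h0, hr⟩ := hS U hU hmem
    exact ⟨r₀, h0, fun r h x hx hd => ⟨U, hU, hr r h x hx hd⟩⟩
  | basic U hU =>
    rcases hU with ⟨x, r, rfl⟩ | ⟨σ, r, ε, hr, hε, rfl⟩
    · obtain ⟨y, -, hy⟩ := hρW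
      cases hy
    rcases hρW with ⟨y, hy, -⟩ | ⟨τ, hτ, hτ0, hτr⟩
    · cases hy
    obtain ⟨C', hC'⟩ : Asymptotic ρ τ :=
      Quotient.exact (s := asymptoticSetoid X) (Sum.inr_injective hτ)
    have hC'0 : 0 ≤ C' := dist_nonneg.trans (hC' 0)
    set o := ρ 0 with ho
    set p := σ 0 with hp
    set e := dist o p with he
    have he0 : 0 ≤ e := dist_nonneg
    set η := ε - dist (τ r) (σ r) with hη
    have hηpos : 0 < η := by linarith
    set B := e + C + C' with hB
    have hB0 : 0 ≤ B := by positivity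
    have hr' : (0 : ℝ) < r := by exact_mod_cast hr
    -- Change of base point: seen from `p`, the points at radius about `r'` differ by at most `B`,
    -- independently of `r'`. Projected to radius `r` the difference shrinks like `2 * r * B / r'`,
    -- finally below the margin `η`.
    refine ⟨Real.toNNReal (B + r + 1 + 2 * r * B / η), by
      rw [Real.toNNReal_pos]; positivity, fun r' hr0 x hx hd => ?_⟩
    have hr0' : B + r + 1 + 2 * r * B / η ≤ r' := Real.toNNReal_le_iff_le_coe.1 hr0
    have hq0 : 0 ≤ 2 * r * B / η := by positivity
    have hDpos : 0 < dist o x := lt_of_le_of_lt r'.2 hx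
    have hθ : (r' : ℝ) / dist o x ∈ Icc (0 : ℝ) 1 := ⟨by positivity, (div_le_one hDpos).2 hx.le⟩
    set θ := (r' : ℝ) / dist o x with hθd
    have h1 := hX.dist_pt_pt_le p x o x hθ
    rw [dist_self, mul_zero, add_zero, dist_comm p] at h1
    have h2 := mul_le_of_le_one_left he0 (show 1 - θ ≤ 1 by linarith [hθ.1])
    set a := hX.pt p x θ with ha
    have hab : dist a (τ r') ≤ B := by
      linarith [dist_triangle4 a (hX.pt o x θ) (ρ r') (τ r'), hC' r']
    have hpb : dist p (τ r') = r' := by rw [← hτ0]; exact τ.dist_zero r'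
    have hpa : r + 1 + 2 * r * B / η ≤ dist p a := by
      have := dist_triangle p a (τ r')
      linarith
    have hpapos : 0 < dist p a := by linarith
    have h3 := hX.dist_pt_div_le p a (τ r') hr'.le (by linarith) (by linarith) hpapos (by linarith)
    have h4 : hX.pt p a (r / dist p a) = hX.pt p x (r / dist p x) :=
      hX.pt_div_pt p x hθ hr'.le (by linarith) hpapos
    have hrr' : r ≤ r' := by
      have : (r : ℝ) ≤ r' := by linarith
      exact_mod_cast this
    have h5 : hX.pt p (τ r') (r / dist p (τ r')) = τ r := by
      rw [hpb, ← hτ0]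
      exact hX.pt_ray_div τ (lt_of_lt_of_le hr hrr') hrr'
    rw [h4, h5] at h3
    have h6 : 2 * (r / dist p a) * dist a (τ r') < η := by
      have : 2 * (r / dist p a) * dist a (τ r') ≤ 2 * (r / dist p a) * B :=
        mul_le_mul_of_nonneg_left hab (by positivity)
      refine this.trans_lt ?_
      rw [show 2 * (r / dist p a) * B = 2 * r * B / dist p a by ring, div_lt_iff₀ hpapos]
      have h7 : 2 * r * B / η * η = 2 * r * B := div_mul_cancel₀ _ hηpos.ne'
      have h8 : 2 * r * B / η < dist p a := by linarith
      have h9 := mul_lt_mul_of_pos_right h8 hηpos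
      linarith
    have hpx : (r : ℝ) < dist p x := by
      have : dist p a = θ * dist p x := hX.dist_left_pt _ _ hθ
      have h7 := mul_le_of_le_one_left (dist_nonneg (x := p) (y := x)) hθ.2
      linarith
    refine Or.inl ⟨x, rfl, hpx, _, hX.pt_spec p x, ?_⟩
    rw [hX.segment_eq_pt (hX.pt_spec p x) hr'.le hpx.le (by linarith)]
    linarith [dist_triangle (hX.pt p x (r / dist p x)) (τ r) (σ r)]

theorem IsHadamard.exists_mem_of_mem_limitSet (hX : IsHadamard X) (ρ : GeodesicRay X)
    {Γ : Subgroup (X ≃ᵢ X)} (h : ρ.endpoint ∈ limitSet Γ (ρ 0)) {r : ℝ≥0} (hr : 0 < r) :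
    ∃ γ ∈ Γ, (r : ℝ) < dist (ρ 0) (γ (ρ 0)) ∧
      dist (hX.pt (ρ 0) (γ (ρ 0)) (r / dist (ρ 0) (γ (ρ 0)))) (ρ r) < 1 := by
  have hopen : IsOpen (coneNeighborhood ρ r 1) :=
    TopologicalSpace.isOpen_generateFrom_of_mem (Or.inr ⟨ρ, r, 1, hr, one_pos, rfl⟩)
  obtain ⟨p, hp, x, ⟨γ, hγ, hx⟩, rfl⟩ := mem_closure_iff.1 h _ hopen
    (Or.inr ⟨ρ, rfl, rfl, by simp⟩)
  rcases hp with ⟨y, hy, hry, τ, hτ, hd⟩ | ⟨τ, hy, -⟩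
  · obtain rfl : x = y := Sum.inl_injective hy
    subst hx
    refine ⟨γ, hγ, hry, ?_⟩
    rwa [hX.segment_eq_pt hτ r.coe_nonneg hry.le (lt_of_le_of_lt r.coe_nonneg hry)] at hd
  · cases hy

/-- By convexity, closeness at a late time bounds the distance at all earlier times; the parameters
`s` and `t` differ by at most `K + d`. -/
theorem IsHadamard.asymptotic_of_frequently_close (hX : IsHadamard X) {a b : GeodesicRay X} {K : ℝ}
    (h : ∀ N : ℝ≥0, ∃ s ≥ N, ∃ t, dist (a s) (b t) ≤ K) : Asymptotic a b := by
  set d := dist (a 0) (b 0) with hd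
  have hd0 : 0 ≤ d := dist_nonneg
  obtain ⟨_, -, _, hK⟩ := h 0
  have hK0 : 0 ≤ K := dist_nonneg.trans hK
  refine ⟨2 * d + 2 * K, fun τ => ?_⟩
  obtain ⟨s, hs, t, hst⟩ := h (τ + 1)
  have hspos : 0 < s := lt_of_lt_of_le (by positivity) hs
  have hτs : τ ≤ s := (le_self_add).trans hs
  have h1 : dist (b t) (b s) ≤ K + d := by
    rw [b.isometry.dist_eq, NNReal.dist_eq, abs_le]
    have e1 := a.dist_zero s
    have e2 := b.dist_zero t
    constructor
    · linarith [dist_triangle4 (a 0) (b 0) (b t) (a s), dist_comm (b t) (a s)]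
    · linarith [dist_triangle4 (b 0) (a 0) (a s) (b t), dist_comm (b 0) (a 0)]
  have h2 : dist (a s) (b s) ≤ 2 * K + d := by linarith [dist_triangle (a s) (b t) (b s)]
  have hm : (τ : ℝ) / s ∈ Icc (0 : ℝ) 1 :=
    ⟨by positivity, (div_le_one (by exact_mod_cast hspos)).2 (by exact_mod_cast hτs)⟩
  have h3 := hX.dist_pt_pt_le (a 0) (a s) (b 0) (b s) hm
  rw [hX.pt_ray_div a hspos hτs, hX.pt_ray_div b hspos hτs] at h3
  have h4 := mul_le_of_le_one_left hd0 (show 1 - (τ : ℝ) / s ≤ 1 by linarith [hm.1])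
  have h5 := mul_le_of_le_one_left (dist_nonneg (x := a s) (y := b s)) hm.2
  linarith

theorem GeodesicLine.exists_ray (v : GeodesicLine X) (s : ℝ) :
    ∃ σ ∈ ({v.negRay, v.posRay} : Set (GeodesicRay X)), v s = σ ⟨|s|, abs_nonneg s⟩ := by
  rcases le_total 0 s with h | h
  · refine ⟨v.posRay, by simp, ?_⟩
    change v s = v |s|
    rw [abs_of_nonneg h]
  · refine ⟨v.negRay, by simp, ?_⟩
    change v s = v (-|s|)
    rw [abs_of_nonpos h, neg_neg]

/-- Otherwise a half of `v` and a half of `w` would be asymptotic. -/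
theorem IsHadamard.lines_diverge (hX : IsHadamard X) {v w : GeodesicLine X}
    (h : Disjoint ({v.negEnd, v.posEnd} : Set (Boundary X)) {w.negEnd, w.posEnd}) (K : ℝ) :
    ∃ N : ℝ, ∀ s t, dist (v s) (w t) ≤ K → |s| ≤ N := by
  by_contra! hcon
  have hno : ∀ a ∈ ({v.negRay, v.posRay} : Set (GeodesicRay X)),
      ∀ b ∈ ({w.negRay, w.posRay} : Set (GeodesicRay X)),
      ∃ N : ℝ≥0, ∀ s ≥ N, ∀ t, K < dist (a s) (b t) := by
    intro a ha b hb
    by_contra! hc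
    have hab : a.endpoint = b.endpoint :=
      Quotient.sound (s := asymptoticSetoid X) (hX.asymptotic_of_frequently_close hc)
    refine Set.disjoint_left.1 h (?_ : a.endpoint ∈ _) ?_
    · rcases ha with rfl | rfl
      · exact Or.inl rfl
      · exact Or.inr rfl
    · rw [hab]
      rcases hb with rfl | rfl
      · exact Or.inl rfl
      · exact Or.inr rfl
  choose! N hN using hno
  set M : ℝ≥0 := max (max (N v.negRay w.negRay) (N v.negRay w.posRay))
    (max (N v.posRay w.negRay) (N v.posRay w.posRay)) with hM
  obtain ⟨s, t, hst, hs⟩ := hcon M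
  obtain ⟨a, ha, has⟩ := v.exists_ray s
  obtain ⟨b, hb, hbt⟩ := w.exists_ray t
  have hle : N a b ≤ ⟨|s|, abs_nonneg s⟩ := by
    refine le_trans ?_ (show M ≤ ⟨|s|, abs_nonneg s⟩ from hs.le)
    rcases ha with rfl | rfl <;> rcases hb with rfl | rfl <;> simp [hM]
  have := hN a ha b hb _ hle ⟨|t|, abs_nonneg t⟩
  rw [← has, ← hbt] at this
  linarith

/-! ### Contracting lines and ping-pong -/

theorem IsContracting.mono {hX : IsHadamard X} {w : ℝ → X} {L R L' R' : ℝ}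
    (h : IsContracting hX w L R) (hL : L ≤ L') (hR : R ≤ R') : IsContracting hX w L' R' := by
  intro x y t₀ t₁ s hx hy h0 h1
  obtain ⟨θ, hθ, hd⟩ := h x y t₀ t₁ s hx hy (by linarith) (by linarith)
  exact ⟨θ, hθ, hd.trans hR⟩

theorem near_iso (γ : X ≃ᵢ X) (w : ℝ → X) (x : X) (t : ℝ) :
    Near (fun s => γ (w s)) (γ x) t ↔ Near w x t := by
  simp [Near, γ.dist_eq]

theorem IsContracting.iso {hX : IsHadamard X} {w : ℝ → X} {L R : ℝ}
    (h : IsContracting hX w L R) (γ : X ≃ᵢ X) : IsContracting hX (fun s => γ (w s)) L R := by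
  intro x y t₀ t₁ s hx hy h0 h1
  rw [← γ.apply_symm_apply x, near_iso] at hx
  rw [← γ.apply_symm_apply y, near_iso] at hy
  obtain ⟨θ, hθ, hd⟩ := h _ _ t₀ t₁ s hx hy h0 h1
  refine ⟨θ, hθ, ?_⟩
  rwa [← γ.dist_eq, hX.map_pt γ _ _ hθ, γ.apply_symm_apply, γ.apply_symm_apply] at hd

theorem IsContracting.symm {hX : IsHadamard X} {w : ℝ → X} {L R : ℝ}
    (h : IsContracting hX w L R) {x y : X} {t₀ t₁ s : ℝ} (hx : Near w x t₀) (hy : Near w y t₁)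
    (h0 : t₁ + L ≤ s) (h1 : s + L ≤ t₀) :
    ∃ θ ∈ Icc (0 : ℝ) 1, dist (hX.pt x y θ) (w s) ≤ R := by
  obtain ⟨θ, hθ, hd⟩ := h y x t₁ t₀ s hy hx h0 h1
  refine ⟨1 - θ, ⟨by linarith [hθ.2], by linarith [hθ.1]⟩, ?_⟩
  rwa [← hX.pt_symm x y hθ]

theorem IsContracting.exists_pt_near {hX : IsHadamard X} {w : ℝ → X} {L R : ℝ}
    (h : IsContracting hX w L R) (hw : Isometry w) {x y : X} {t₀ t₁ : ℝ} (hL : 0 ≤ L)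
    (hx : Near w x t₀) (hy : Near w y t₁) (h01 : 2 * L ≤ |t₁ - t₀|) :
    ∃ θ ∈ Icc (0 : ℝ) 1, dist (hX.pt x y θ) (w t₀) ≤ R + L := by
  have hwd := Isometry.dist_real hw
  rcases le_total t₀ t₁ with hle | hle
  · rw [abs_of_nonneg (by linarith)] at h01
    obtain ⟨θ, hθ, hd⟩ := h x y t₀ t₁ (t₀ + L) hx hy le_rfl (by linarith)
    refine ⟨θ, hθ, ?_⟩
    have := hwd (t₀ + L) t₀
    rw [add_sub_cancel_left, abs_of_nonneg hL] at this
    linarith [dist_triangle (hX.pt x y θ) (w (t₀ + L)) (w t₀)]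
  · rw [abs_of_nonpos (by linarith)] at h01
    obtain ⟨θ, hθ, hd⟩ := h.symm hx hy (s := t₀ - L) (by linarith) (by linarith)
    refine ⟨θ, hθ, ?_⟩
    have := hwd (t₀ - L) t₀
    rw [sub_sub_cancel_left, abs_neg, abs_of_nonneg hL] at this
    linarith [dist_triangle (hX.pt x y θ) (w (t₀ - L)) (w t₀)]

/-- For close projections the endpoint `y` itself serves as the near point, at the cost of its
distance to the line. -/
theorem IsContracting.exists_pt_near' {hX : IsHadamard X} {w : ℝ → X} {L R : ℝ}
    (h : IsContracting hX w L R) (hw : Isometry w) {x y : X} {t₀ t₁ : ℝ} (hL : 0 ≤ L) (hR : 0 ≤ R)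
    (hx : Near w x t₀) (hy : Near w y t₁) :
    ∃ θ ∈ Icc (0 : ℝ) 1, dist (hX.pt x y θ) (w t₀) ≤ R + 2 * L + dist y (w t₁) := by
  by_cases h01 : 2 * L ≤ |t₁ - t₀|
  · obtain ⟨θ, hθ, hd⟩ := h.exists_pt_near hw hL hx hy h01
    exact ⟨θ, hθ, by linarith [dist_nonneg (x := y) (y := w t₁)]⟩
  · refine ⟨1, by simp, ?_⟩
    rw [hX.pt_one]
    have := Isometry.dist_real hw t₁ t₀
    linarith [dist_triangle y (w t₁) (w t₀)]

/-- Two points whose geodesics from `o` pass near a point `q` far away from `o` are seen from `o`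
in nearby directions. -/
theorem IsHadamard.dist_pt_div_le_of_pass (hX : IsHadamard X) {o y z q : X} {θ θ' B r : ℝ}
    (hθ : θ ∈ Icc (0 : ℝ) 1) (hθ' : θ' ∈ Icc (0 : ℝ) 1) (hy : dist (hX.pt o y θ) q ≤ B)
    (hz : dist (hX.pt o z θ') q ≤ B) (hr : 0 ≤ r) (hq : r + B < dist o q) :
    r < dist o z ∧ dist (hX.pt o z (r / dist o z)) (hX.pt o y (r / dist o y)) ≤ 4 * B := by
  have hz1 : r < dist o (hX.pt o z θ') := by
    linarith [dist_triangle o (hX.pt o z θ') q]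
  have hy1 : r < dist o (hX.pt o y θ) := by
    linarith [dist_triangle o (hX.pt o y θ) q]
  have hz2 := hX.dist_left_pt o z hθ'
  have hz3 := mul_le_of_le_one_left (dist_nonneg (x := o) (y := z)) hθ'.2
  refine ⟨by linarith, ?_⟩
  have h := hX.dist_pt_div_le o (hX.pt o z θ') (hX.pt o y θ) hr hz1.le hy1.le
    (by linarith) (by linarith)
  rw [hX.pt_div_pt o z hθ' hr hz1.le (by linarith), hX.pt_div_pt o y hθ hr hy1.le (by linarith)] at h
  refine h.trans ?_
  have h1 : dist (hX.pt o z θ') (hX.pt o y θ) ≤ 2 * B := by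
    linarith [dist_triangle (hX.pt o z θ') q (hX.pt o y θ), dist_comm q (hX.pt o y θ)]
  have h2 : r / dist o (hX.pt o z θ') ≤ 1 := (div_le_one (by linarith)).2 hz1.le
  have h3 := mul_le_of_le_one_left (dist_nonneg (x := hX.pt o z θ') (y := hX.pt o y θ)) h2
  rw [mul_assoc]
  linarith

theorem exists_rankOneAxis {g : X ≃ᵢ X} (hg : IsRankOneIsometry g) :
    ∃ (v : GeodesicLine X) (ℓ : ℝ), IsInvariantGeodesic g v ∧ IsRankOneAxis g v ℓ := by
  obtain ⟨-, v, ⟨ℓ, hℓ, hv⟩, hr⟩ := hg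
  exact ⟨v, ℓ, ⟨ℓ, hℓ, hv⟩, v.isometry, hℓ, hv, hr.exists_bound⟩

/-- If the limit set of `H` is a proper subset of that of the rank one group `Γ`, there is a
contracting axis of an element of `Γ` to which the orbits of `H` have bounded projection. -/
theorem exists_axis_with_bounded_projection [ProperSpace X] (hX : IsHadamard X) (o : X)
    {Γ H : Subgroup (X ≃ᵢ X)} (hrank : IsRankOneGroup Γ)
    (hlim : limitSet H o ⊂ limitSet Γ o) :
    ∃ g ∈ Γ, ∃ (w : ℝ → X) (ℓ L R D : ℝ), Isometry w ∧ 0 < ℓ ∧ (∀ t, g (w t) = w (t + ℓ)) ∧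
      IsContracting hX w L R ∧ 0 ≤ L ∧ 0 ≤ R ∧
        ∀ h ∈ H, ∀ t, Near w (h o) t → |t| ≤ D := by
  obtain ⟨g₁, hg₁, g₂, hg₂, hr₁, hr₂, hind⟩ := hrank
  obtain ⟨v₁, ℓ₁, hinv₁, hv₁⟩ := exists_rankOneAxis hr₁
  obtain ⟨v₂, ℓ₂, hinv₂, hv₂⟩ := exists_rankOneAxis hr₂
  have hdis := hind v₁ v₂ hinv₁ hinv₂
  obtain ⟨L₁, R₁, hc₁⟩ := hv₁.isContracting hX
  obtain ⟨L₂, R₂, hc₂⟩ := hv₂.isContracting hX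
  set L := max 0 (max L₁ L₂) with hLdef
  set R := max 0 (max R₁ R₂) with hRdef
  have hL : 0 ≤ L := le_max_left _ _
  have hR : 0 ≤ R := le_max_left _ _
  replace hc₁ : IsContracting hX v₁ L R := hc₁.mono (by simp [hLdef]) (by simp [hRdef])
  replace hc₂ : IsContracting hX v₂ L R := hc₂.mono (by simp [hLdef]) (by simp [hRdef])
  set c := max (dist o (v₁ 0)) (dist o (v₂ 0)) with hcdef
  have hc1 : dist o (v₁ 0) ≤ c := le_max_left _ _
  have hc2 : dist o (v₂ 0) ≤ c := le_max_right _ _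
  have hc0 : 0 ≤ c := dist_nonneg.trans hc1
  obtain ⟨ξ, hξΓ, hξH⟩ := exists_of_ssubset hlim
  obtain ⟨ρ, rfl, hρ⟩ := hX.exists_ray o (Quotient.out ξ)
  obtain rfl : ρ.endpoint = ξ :=
    (Quotient.sound (s := asymptoticSetoid X) hρ).trans (Quotient.out_eq ξ)
  set o := ρ 0 with ho
  set B := R + 2 * L + c with hB
  have hB0 : 0 ≤ B := by positivity
  obtain ⟨r₀, hr0, hW⟩ := hX.ofPoint_mem_of_isOpen ρ (C := 4 * B + 1) (by positivity)
    (isClosed_closure (s := ofPoint '' {x : X | ∃ γ ∈ H, γ o = x})).isOpen_compl hξH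
  set K : ℝ := r₀ + B with hK
  obtain ⟨N, hN⟩ := hX.lines_diverge hdis (2 * K)
  -- If both translated axes met the `K`-ball about `o`, then `d(o, γ o) ≤ K + N + c`; beyond this
  -- radius at least one of them avoids it.
  set r : ℝ≥0 := max r₀ (Real.toNNReal (K + N + c)) with hr
  have hrr : r₀ ≤ r := le_max_left _ _
  have hrK : K + N + c ≤ r := Real.toNNReal_le_iff_le_coe.1 (le_max_right _ _)
  have hrpos : 0 < r := lt_of_lt_of_le hr0 hrr
  obtain ⟨γ, hγ, hγr, hγd⟩ := hX.exists_mem_of_mem_limitSet ρ hξΓ hrpos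
  have hγ0 : dist (hX.pt o (γ o) (r₀ / dist o (γ o))) (ρ r₀) ≤ 1 := by
    have hD : 0 < dist o (γ o) := lt_of_le_of_lt r.2 hγr
    have hm : (r : ℝ) / dist o (γ o) ∈ Icc (0 : ℝ) 1 := ⟨by positivity, (div_le_one hD).2 hγr.le⟩
    have hrpos' : (0 : ℝ) < r := by exact_mod_cast hrpos
    have hm' : (r₀ : ℝ) / r ∈ Icc (0 : ℝ) 1 :=
      ⟨by positivity, (div_le_one hrpos').2 (by exact_mod_cast hrr)⟩
    have h1 := hX.dist_pt_pt_same_left o (hX.pt o (γ o) (r / dist o (γ o))) (ρ r) hm'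
    rw [hX.pt_pt_left _ _ hm hm', hX.pt_ray_div ρ hrpos hrr, div_mul_div_cancel₀ hrpos'.ne'] at h1
    exact h1.trans (mul_le_one₀ hm'.2 dist_nonneg hγd.le)
  -- one of the two translated axes is far from `o`
  have main : ∀ (g : X ≃ᵢ X) (v : ℝ → X) (ℓ : ℝ), g ∈ Γ → IsRankOneAxis g v ℓ →
      IsContracting hX v L R → dist o (v 0) ≤ c → (∀ s, K < dist o (γ (v s))) →
      ∃ g ∈ Γ, ∃ (w : ℝ → X) (ℓ L R D : ℝ), Isometry w ∧ 0 < ℓ ∧ (∀ t, g (w t) = w (t + ℓ)) ∧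
        IsContracting hX w L R ∧ 0 ≤ L ∧ 0 ≤ R ∧
        ∀ h ∈ H, ∀ t, Near w (h o) t → |t| ≤ D := by
    intro g v ℓ hg hv hcon hvc hfar
    set w : ℝ → X := fun s => γ (v s) with hw
    have hwi : Isometry w := γ.isometry.comp hv.isometry
    have hwc : IsContracting hX w L R := hcon.iso γ
    obtain ⟨t₀, ht₀⟩ := exists_near hwi o
    obtain ⟨τ, hτ⟩ := exists_near hwi (γ o)
    refine ⟨γ * g * γ⁻¹, Γ.mul_mem (Γ.mul_mem hγ hg) (Γ.inv_mem hγ), w, ℓ, L, R, |t₀| + 2 * L,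
      hwi, hv.pos, fun t => ?_, hwc, hL, hR, fun h hh t ht => ?_⟩
    · rw [IsometryEquiv.mul_apply, IsometryEquiv.mul_apply]
      have : γ⁻¹ (w t) = v t := γ.symm_apply_apply (v t)
      rw [this, hv.apply]
    -- If `h o` projects far from the projection `w t₀` of `o`, the geodesics from `o` to `h o` and
    -- to `γ o` both pass near the distant point `w t₀`. Then `h o` is seen from `o` in nearly the
    -- direction of `ρ` and lies in the neighborhood that avoids `H o`.
    · by_contra! hlt
      have h2L : 2 * L ≤ |t - t₀| := by
        have := abs_sub_abs_le_abs_sub t t₀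
        linarith
      obtain ⟨θ, hθ, hd⟩ := hwc.exists_pt_near hwi hL ht₀ ht h2L
      obtain ⟨θ', hθ', hd'⟩ := hwc.exists_pt_near' hwi hL hR ht₀ hτ
      have hτc : dist (γ o) (w τ) ≤ c := by
        refine (hτ 0).trans ?_
        rw [hw, γ.dist_eq]
        exact hvc
      obtain ⟨h1, h2⟩ := hX.dist_pt_div_le_of_pass hθ' hθ (q := w t₀) (B := B)
        (by linarith) (by linarith) r₀.2 (hfar t₀)
      refine hW r₀ le_rfl (h o) h1 ?_ (subset_closure ⟨h o, ⟨h, hh, rfl⟩, rfl⟩)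
      exact (dist_triangle _ _ _).trans (add_le_add h2 hγ0)
  by_cases h1 : ∀ s, K < dist o (γ (v₁ s))
  · exact main g₁ v₁ ℓ₁ hg₁ hv₁ hc₁ hc1 h1
  · refine main g₂ v₂ ℓ₂ hg₂ hv₂ hc₂ hc2 fun t => ?_
    push Not at h1
    obtain ⟨s, hs⟩ := h1
    by_contra! ht
    have h2 : dist (v₁ s) (v₂ t) ≤ 2 * K := by
      rw [← γ.dist_eq]
      linarith [dist_triangle (γ (v₁ s)) o (γ (v₂ t)), dist_comm o (γ (v₁ s))]
    have h3 := hN s t h2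
    have h4 : dist (γ (v₁ s)) (γ (v₁ 0)) = |s| := by
      rw [γ.dist_eq, Isometry.dist_real v₁.isometry, sub_zero]
    have h5 : dist (γ (v₁ 0)) (γ o) = dist o (v₁ 0) := by rw [γ.dist_eq, dist_comm]
    linarith [dist_triangle4 o (γ (v₁ s)) (γ (v₁ 0)) (γ o)]

/-- Long elements of `H` map the points projecting far out on a contracting line `w` to points
with bounded projection. -/
theorem IsContracting.abs_lt_of_near [ProperSpace X] {hX : IsHadamard X} {w : ℝ → X} {L R : ℝ}
    (hc : IsContracting hX w L R) (hw : Isometry w) (hL : 0 ≤ L) (hR : 0 ≤ R) (o : X)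
    {H : Subgroup (X ≃ᵢ X)} {D : ℝ} (hD : ∀ h ∈ H, ∀ t, Near w (h o) t → |t| ≤ D) :
    ∃ T R₀ : ℝ, 0 < T ∧ 0 < R₀ ∧ ∀ h ∈ H, R₀ ≤ dist o (h o) → ∀ x t₁ t, T ≤ t₁ → Near w x t₁ →
      Near w (h x) t → |t| < T := by
  have hwd := Isometry.dist_real hw
  obtain ⟨t₃, ht₃⟩ := exists_near hw o
  have ht₃D : |t₃| ≤ D := hD 1 H.one_mem t₃ ht₃
  have hD0 : 0 ≤ D := (abs_nonneg _).trans ht₃D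
  set d := dist o (w 0) with hd
  have hd0 : 0 ≤ d := dist_nonneg
  set C := d + D + L with hC
  set S := 2 * d + D + 4 * R + 2 * C + 1 + (D + L) with hS
  have howd : ∀ s, dist o (w s) ≤ d + |s| ∧ |s| ≤ d + dist o (w s) := by
    intro s
    have h1 := hwd 0 s
    rw [zero_sub, abs_neg] at h1
    constructor
    · linarith [dist_triangle o (w 0) (w s)]
    · linarith [dist_triangle (w 0) o (w s), dist_comm o (w 0)]
  refine ⟨S + L, R + S + d + R + C + 1, by positivity, by positivity,
    fun h hh hlong x t₁ t hT hx ht => ?_⟩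
  -- Otherwise the geodesic from `o` to `h x` passes first near `w (±S)` and later near `h o`: the
  -- latter because its preimage from `h⁻¹ o` to `x` passes near `w (D + L)`. So `h o` is closer to
  -- `w (±S)` than to `o` by about `S`, too much for a point with projection in `[-D, D]`.
  by_contra! hTt
  obtain ⟨t₂, ht₂⟩ := exists_near hw (h⁻¹ o)
  have ht₂D := (abs_le.1 (hD _ (H.inv_mem hh) t₂ ht₂)).2
  obtain ⟨t₄, ht₄⟩ := exists_near hw (h o)
  have ht₄D := hD _ hh t₄ ht₄
  obtain ⟨θ₁, hθ₁, h1⟩ := hc _ _ t₂ t₁ (D + L) ht₂ hx (by linarith) (by linarith)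
  rw [← h.dist_eq, hX.map_pt h _ _ hθ₁] at h1
  have hho : h (h⁻¹ o) = o := h.apply_symm_apply o
  rw [hho] at h1
  have h2 : dist (hX.pt o (h x) θ₁) (h o) ≤ R + C := by
    have h3 := (howd (D + L)).1
    rw [abs_of_nonneg (by linarith), dist_comm, ← h.dist_eq] at h3
    linarith [dist_triangle (hX.pt o (h x) θ₁) (h (w (D + L))) (h o)]
  obtain ⟨s, hs, θ₂, hθ₂, h3⟩ : ∃ s, |s| = S ∧ ∃ θ₂ ∈ Icc (0 : ℝ) 1,
      dist (hX.pt o (h x) θ₂) (w s) ≤ R := by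
    have hS0 : 0 ≤ S := by positivity
    rw [abs_le] at ht₃D
    rcases le_total 0 t with h0 | h0
    · rw [abs_of_nonneg h0] at hTt
      exact ⟨S, abs_of_nonneg hS0, hc _ _ t₃ t S ht₃ ht (by linarith) hTt⟩
    · rw [abs_of_nonpos h0] at hTt
      exact ⟨-S, by rw [abs_neg, abs_of_nonneg hS0],
        hc.symm ht₃ ht (by linarith) (by linarith)⟩
  have e1 := hX.dist_left_pt o (h x) hθ₁
  have e2 := hX.dist_left_pt o (h x) hθ₂
  have e3 := hX.dist_pt_pt o (h x) hθ₂ hθ₁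
  have f1 : dist o (hX.pt o (h x) θ₂) ≤ R + S + d := by
    linarith [dist_triangle o (w s) (hX.pt o (h x) θ₂), (howd s).1,
      dist_comm (w s) (hX.pt o (h x) θ₂)]
  have f2 : R + S + d + 1 ≤ dist o (hX.pt o (h x) θ₁) := by
    linarith [dist_triangle o (hX.pt o (h x) θ₁) (h o)]
  have hθ : θ₂ ≤ θ₁ := by
    by_contra! hlt
    have := mul_le_mul_of_nonneg_right hlt.le (dist_nonneg (x := o) (y := h x))
    linarith
  rw [abs_of_nonpos (by linarith)] at e3
  have f3 : dist o (hX.pt o (h x) θ₁) =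
      dist o (hX.pt o (h x) θ₂) + dist (hX.pt o (h x) θ₂) (hX.pt o (h x) θ₁) := by
    rw [e1, e2, e3]; ring
  have f4 : dist o (hX.pt o (h x) θ₁) ≤ dist o (h o) + (R + C) := by
    linarith [dist_triangle o (h o) (hX.pt o (h x) θ₁), dist_comm (h o) (hX.pt o (h x) θ₁)]
  have f5 : S - d - R ≤ dist o (hX.pt o (h x) θ₂) := by
    linarith [dist_triangle o (hX.pt o (h x) θ₂) (w s), (howd s).2]
  have f6 : dist (h o) (w t₄) ≤ (R + C) + dist (hX.pt o (h x) θ₂) (hX.pt o (h x) θ₁) + R := by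
    refine (ht₄ s).trans ?_
    have := dist_triangle4 (h o) (hX.pt o (h x) θ₁) (hX.pt o (h x) θ₂) (w s)
    rw [dist_comm (h o) (hX.pt o (h x) θ₁), dist_comm (hX.pt o (h x) θ₁) (hX.pt o (h x) θ₂)] at this
    linarith
  have f7 : dist o (h o) ≤ d + D + dist (h o) (w t₄) := by
    linarith [dist_triangle o (w t₄) (h o), (howd t₄).1, dist_comm (h o) (w t₄)]
  linarith

/-- Ping-pong between long elements of `H` and an element of `Γ`. -/
theorem exists_pingpong [ProperSpace X] (hX : IsHadamard X) (o : X)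
    {Γ H : Subgroup (X ≃ᵢ X)} (hrank : IsRankOneGroup Γ)
    (hlim : limitSet H o ⊂ limitSet Γ o) :
    ∃ a ∈ Γ, ∃ (U : Set X) (R₀ : ℝ), U.Nonempty ∧ 0 < R₀ ∧ ∀ h ∈ H, R₀ ≤ dist o (h o) →
      ∀ x ∈ U, h x ∉ U ∧ a (h x) ∈ U := by
  obtain ⟨g, hg, w, ℓ, L, R, D, hw, hℓ, hgw, hc, hL, hR, hD⟩ :=
    exists_axis_with_bounded_projection hX o hrank hlim
  obtain ⟨T, R₀, hT, hR₀, hmain⟩ := hc.abs_lt_of_near hw hL hR o hD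
  obtain ⟨N, hN⟩ := exists_nat_ge (2 * T / ℓ)
  rw [div_le_iff₀ hℓ] at hN
  refine ⟨g ^ N, Γ.pow_mem hg N, {x | ∃ t, T ≤ t ∧ Near w x t}, R₀,
    ⟨w T, T, le_rfl, fun s => by rw [dist_self]; exact dist_nonneg⟩, hR₀, ?_⟩
  rintro h hh hlong x ⟨t₁, hT₁, hx⟩
  constructor
  · rintro ⟨t, hTt, ht⟩
    have := hmain h hh hlong x t₁ t hT₁ hx ht
    rw [abs_of_nonneg (by linarith)] at this
    linarith
  · obtain ⟨t, ht⟩ := exists_near hw (h x)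
    have h1 := abs_lt.1 (hmain h hh hlong x t₁ t hT₁ hx ht)
    refine ⟨t + N * ℓ, by linarith, fun s => ?_⟩
    have h2 := pow_apply_axis hgw N (s - N * ℓ)
    rw [sub_add_cancel] at h2
    rw [← pow_apply_axis hgw, ← h2, (g ^ N).dist_eq, (g ^ N).dist_eq]
    exact ht _

/-- In a discrete group, an element moving a suitable compact set very little is trivial. -/
theorem exists_compact_of_discrete {Γ : Subgroup (X ≃ᵢ X)} (hdisc : DiscreteTopology Γ) :
    ∃ (K : Set X) (ε : ℝ), IsCompact K ∧ 0 < ε ∧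
      ∀ γ ∈ Γ, (∀ x ∈ K, dist x (γ x) < ε) → γ = 1 := by
  have h1 : ({1} : Set Γ) ∈ 𝓝 (1 : Γ) := (isOpen_discrete _).mem_nhds rfl
  rw [nhds_induced, nhds_induced] at h1
  obtain ⟨U, ⟨V, hV, hVU⟩, hU⟩ := h1
  obtain ⟨⟨K, E⟩, ⟨hK, hE⟩, hKE⟩ :=
    (nhds_basis_uniformity' ContinuousMap.hasBasis_compactConvergenceUniformity).mem_iff.1 hV
  obtain ⟨ε, hε, hεE⟩ := Metric.mem_uniformity_dist.1 hE
  refine ⟨K, ε, hK, hε, fun γ hγ hx => ?_⟩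
  have hm : (⟨γ, hγ⟩ : Γ) ∈ ({1} : Set Γ) := hU (hVU (hKE fun x hxK => hεE (hx x hxK)))
  exact congrArg Subtype.val hm

/-- Pigeonhole on finite `ε / 4`-nets: if infinitely many elements moved `o` by at most `R`, two of
them would nearly agree on `K`, and their quotient would be trivial. -/
theorem finite_ball_of_discrete [ProperSpace X] {Γ : Subgroup (X ≃ᵢ X)}
    (hdisc : DiscreteTopology Γ) (o : X) (R : ℝ) :
    {γ : X ≃ᵢ X | γ ∈ Γ ∧ dist o (γ o) ≤ R}.Finite := by
  obtain ⟨K, ε, hK, hε, h1⟩ := exists_compact_of_discrete hdisc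
  obtain ⟨M, hM⟩ := hK.isBounded.subset_closedBall o
  obtain ⟨t, htK, htf, ht⟩ := hK.finite_cover_balls (show 0 < ε / 4 by positivity)
  obtain ⟨t', -, htf', ht'⟩ := (isCompact_closedBall o (M + R)).finite_cover_balls
    (show 0 < ε / 4 by positivity)
  by_contra hinf
  have hcode : ∀ γ : X ≃ᵢ X, dist o (γ o) ≤ R → ∀ k ∈ t, ∃ c ∈ t', dist (γ k) c < ε / 4 := by
    intro γ hγ k hk
    have hk' : dist k o ≤ M := hM (htK hk)
    have : γ k ∈ Metric.closedBall o (M + R) := by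
      rw [Metric.mem_closedBall]
      have h2 := dist_triangle (γ k) (γ o) o
      rw [γ.dist_eq, dist_comm (γ o)] at h2
      linarith
    simpa using ht' this
  choose! f hf hfd using hcode
  have := htf.to_subtype
  obtain ⟨γ, hγ, γ', hγ', hne, heq⟩ := Set.Infinite.exists_ne_map_eq_of_mapsTo
    (f := fun (γ : X ≃ᵢ X) (k : t) => f γ k) (t := {F : t → X | ∀ k, F k ∈ t'}) hinf
    (fun γ hγ k => hf γ hγ.2 k k.2) (Set.Finite.pi' fun _ => htf')
  have hone : γ⁻¹ * γ' = 1 := by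
    refine h1 _ (Γ.mul_mem (Γ.inv_mem hγ.1) hγ'.1) fun x hx => ?_
    obtain ⟨k, hk, hxk⟩ := mem_iUnion₂.1 (ht hx)
    rw [Metric.mem_ball] at hxk
    have e1 := hfd γ hγ.2 k hk
    have e2 := hfd γ' hγ'.2 k hk
    have e3 : f γ k = f γ' k := congrFun heq ⟨k, hk⟩
    rw [← e3] at e2
    rw [← γ.dist_eq, IsometryEquiv.mul_apply]
    have e4 : γ (γ⁻¹ (γ' x)) = γ' x := γ.apply_symm_apply _
    rw [e4]
    have e5 := γ.dist_eq x k
    have e6 := γ'.dist_eq x k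
    have e7 := dist_triangle4 (γ x) (γ k) (f γ k) (γ' x)
    have e8 := dist_triangle (f γ k) (γ' k) (γ' x)
    rw [dist_comm (f γ k) (γ' k), dist_comm (γ' k) (γ' x)] at e8
    linarith
  exact hne (inv_mul_eq_one.1 hone)

/-! ### Poincaré series -/

theorem criticalExponent_nonneg (Γ : Subgroup (X ≃ᵢ X)) (o : X) : 0 ≤ criticalExponent Γ o := by
  refine le_limsup_of_frequently_le' (Eventually.frequently ?_)
  filter_upwards [eventually_ge_atTop 0] with R hR
  exact_mod_cast div_nonneg (Real.log_natCast_nonneg _) hR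

/-- The Poincaré series converges above the critical exponent. -/
theorem summable_of_criticalExponent_lt {Γ : Subgroup (X ≃ᵢ X)} {o : X}
    (hfin : ∀ R, {γ : X ≃ᵢ X | γ ∈ Γ ∧ dist o (γ o) ≤ R}.Finite) {s : ℝ}
    (h : criticalExponent Γ o < s) :
    Summable fun γ : Γ => Real.exp (-s * dist o ((γ : X ≃ᵢ X) o)) := by
  have hs : 0 ≤ s := by exact_mod_cast ((criticalExponent_nonneg Γ o).trans_lt h).le
  obtain ⟨β, hβ, hβs⟩ := EReal.lt_iff_exists_real_btwn.1 h
  replace hβs : β < s := by exact_mod_cast hβs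
  have hcount : ∀ᶠ R : ℝ in atTop, (orbitCount Γ o R : ℝ) ≤ Real.exp (β * R) := by
    filter_upwards [eventually_lt_of_limsup_lt hβ, eventually_gt_atTop 0] with R h1 hR
    have h2 : Real.log (orbitCount Γ o R) / R < β := by exact_mod_cast h1
    rw [div_lt_iff₀ hR] at h2
    rcases (Nat.cast_nonneg (α := ℝ) (orbitCount Γ o R)).eq_or_lt with h0 | h0
    · rw [← h0]; positivity
    · exact ((Real.log_lt_iff_lt_exp h0).1 h2).le
  set b : ℕ → ℝ := fun j => orbitCount Γ o (j + 1) * Real.exp (-s * j) with hb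
  have hb0 : ∀ j, 0 ≤ b j := fun j => by positivity
  have hbs : Summable b := by
    have hg : Summable fun j : ℕ => Real.exp β * Real.exp (β - s) ^ j :=
      (summable_geometric_of_lt_one (Real.exp_pos _).le
        (Real.exp_lt_one_iff.2 (by linarith))).mul_left _
    refine hg.of_norm_bounded_eventually_nat ?_
    have ht : Tendsto (fun j : ℕ => (j : ℝ) + 1) atTop atTop :=
      tendsto_atTop_add_const_right _ _ tendsto_natCast_atTop_atTop
    filter_upwards [ht.eventually hcount] with j hj
    rw [Real.norm_of_nonneg (hb0 j)]
    refine (mul_le_mul_of_nonneg_right hj (Real.exp_pos _).le).trans (le_of_eq ?_)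
    rw [← Real.exp_nat_mul, ← Real.exp_add, ← Real.exp_add]
    congr 1; ring
  refine summable_of_sum_le (c := ∑' j, b j) (fun γ => (Real.exp_pos _).le) fun F => ?_
  -- Sorted into shells `[j, j + 1)` of displacement, the series is dominated by the geometric
  -- series of ratio `exp (β - s)`.
  set fl : Γ → ℕ := fun γ => ⌊dist o ((γ : X ≃ᵢ X) o)⌋₊ with hfl
  rw [← Finset.sum_fiberwise_of_maps_to (t := F.image fl) (g := fl)
    (fun γ hγ => Finset.mem_image_of_mem _ hγ)]
  refine le_trans (Finset.sum_le_sum fun j _ => ?_) (hbs.sum_le_tsum _ fun j _ => hb0 j)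
  have hcard : ((F.filter fun γ => fl γ = j).card : ℝ) ≤ orbitCount Γ o (j + 1) := by
    rw [orbitCount, ← Finset.card_map (Function.Embedding.subtype _), ← Set.ncard_coe_finset]
    refine Nat.cast_le.2 (Set.ncard_le_ncard ?_ (hfin _))
    intro γ hγ
    simp only [Finset.coe_map, mem_image, SetLike.mem_coe, Finset.mem_filter] at hγ
    obtain ⟨γ', ⟨-, hγj⟩, rfl⟩ := hγ
    refine ⟨γ'.2, ?_⟩
    have := (Nat.lt_floor_add_one (dist o ((γ' : X ≃ᵢ X) o))).le
    rw [← hγj]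
    exact_mod_cast this
  refine (Finset.sum_le_card_nsmul _ _ (Real.exp (-s * j)) fun γ hγ => ?_).trans ?_
  · refine Real.exp_le_exp.2 ?_
    rw [← (Finset.mem_filter.1 hγ).2]
    have := mul_le_mul_of_nonneg_left (Nat.floor_le (dist_nonneg (x := o) (y := (γ : X ≃ᵢ X) o))) hs
    linarith
  · rw [nsmul_eq_mul]
    exact mul_le_mul_of_nonneg_right hcard (Real.exp_pos _).le

theorem dist_mul_apply_le (o : X) (a b : X ≃ᵢ X) :
    dist o ((a * b) o) ≤ dist o (a o) + dist o (b o) := by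
  have := dist_triangle o (a o) (a (b o))
  rwa [a.dist_eq] at this

/-- The Poincaré series of a group containing a free semigroup on elements `a * b`, `b ∈ S`. -/
theorem not_summable_of_pingpong {Γ : Subgroup (X ≃ᵢ X)} (o : X) {a : X ≃ᵢ X} (ha : a ∈ Γ)
    {U : Set X} (hU : U.Nonempty) {S : Finset (X ≃ᵢ X)} (hS : ∀ b ∈ S, b ∈ Γ)
    (hmap : ∀ b ∈ S, ∀ x ∈ U, a (b x) ∈ U)
    (hdisj : ∀ b ∈ S, ∀ b' ∈ S, ∀ x ∈ U, ∀ y ∈ U, b x = b' y → b = b') {s : ℝ} (hs : 0 ≤ s)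
    (hsum : 1 < ∑ b ∈ S, Real.exp (-s * (dist o (a o) + dist o (b o)))) :
    ¬ Summable fun γ : Γ => Real.exp (-s * dist o ((γ : X ≃ᵢ X) o)) := by
  classical
  intro hsm
  obtain ⟨p, hp⟩ := hU
  set A := ∑ b ∈ S, Real.exp (-s * (dist o (a o) + dist o (b o))) with hA
  -- `W` consists of the words of length `k`. One length at a time gives unbounded partial sums, so
  -- words of different lengths need not be compared.
  have key : ∀ k : ℕ, ∃ W : Finset (X ≃ᵢ X), (∀ w ∈ W, w ∈ Γ ∧ w p ∈ U) ∧
      A ^ k ≤ ∑ w ∈ W, Real.exp (-s * dist o (w o)) := by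
    intro k
    induction k with
    | zero =>
      refine ⟨{1}, fun w hw => ?_, ?_⟩
      · obtain rfl := Finset.mem_singleton.1 hw
        exact ⟨Γ.one_mem, hp⟩
      · rw [Finset.sum_singleton, show dist o ((1 : X ≃ᵢ X) o) = 0 from dist_self o]
        simp
    | succ k ih =>
      obtain ⟨W, hW, hWs⟩ := ih
      refine ⟨(S ×ˢ W).image fun q => a * (q.1 * q.2), ?_, ?_⟩
      · intro w hw
        obtain ⟨q, hq, rfl⟩ := Finset.mem_image.1 hw
        obtain ⟨h1, h2⟩ := Finset.mem_product.1 hq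
        exact ⟨Γ.mul_mem ha (Γ.mul_mem (hS _ h1) (hW _ h2).1), hmap _ h1 _ (hW _ h2).2⟩
      · rw [Finset.sum_image, Finset.sum_product, pow_succ, mul_comm, hA, Finset.sum_mul]
        · refine Finset.sum_le_sum fun b _ => ?_
          refine (mul_le_mul_of_nonneg_left hWs (Real.exp_pos _).le).trans ?_
          rw [Finset.mul_sum]
          refine Finset.sum_le_sum fun w _ => ?_
          rw [← Real.exp_add]
          refine Real.exp_le_exp.2 ?_
          have h1 := (dist_mul_apply_le o a (b * w)).trans
            (add_le_add le_rfl (dist_mul_apply_le o b w))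
          have h2 := mul_le_mul_of_nonneg_left h1 hs
          linarith
        · rintro ⟨b, w⟩ hq ⟨b', w'⟩ hq' heq
          obtain ⟨h1, h2⟩ := Finset.mem_product.1 (Finset.mem_coe.1 hq)
          obtain ⟨h1', h2'⟩ := Finset.mem_product.1 (Finset.mem_coe.1 hq')
          have heq' : b * w = b' * w' := mul_left_cancel heq
          obtain rfl : b = b' := hdisj b h1 b' h1' _ (hW w h2).2 _ (hW w' h2').2
            (congrArg (fun γ : X ≃ᵢ X => γ p) heq')
          rw [mul_left_cancel heq']
  obtain ⟨k, hk⟩ := pow_unbounded_of_one_lt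
    (∑' γ : Γ, Real.exp (-s * dist o ((γ : X ≃ᵢ X) o))) hsum
  obtain ⟨W, hW, hWs⟩ := key k
  have h1 := hsm.sum_le_tsum (W.subtype (· ∈ Γ)) fun _ _ => (Real.exp_pos _).le
  rw [Finset.sum_subtype_of_mem (fun w : X ≃ᵢ X => Real.exp (-s * dist o (w o)))
    fun w hw => (hW w hw).1] at h1
  linarith

/-- A group with divergent series contains an `R₀`-separated subset with divergent series. -/
theorem exists_separated_not_summable {H : Subgroup (X ≃ᵢ X)} {o : X} {s R₀ : ℝ} (hs : 0 ≤ s)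
    (hR₀ : 0 < R₀) (hfin : {γ : X ≃ᵢ X | γ ∈ H ∧ dist o (γ o) ≤ R₀}.Finite)
    (hdiv : ¬ Summable fun γ : H => Real.exp (-s * dist o ((γ : X ≃ᵢ X) o))) :
    ∃ T : Set H, 1 ∈ T ∧
      T.Pairwise (fun b b' => R₀ ≤ dist ((b : X ≃ᵢ X) o) ((b' : X ≃ᵢ X) o)) ∧
      ¬ Summable fun b : T => Real.exp (-s * dist o ((b : X ≃ᵢ X) o)) := by
  obtain ⟨T, h1T, hT⟩ := zorn_subset_nonempty
    {T : Set H | T.Pairwise fun b b' => R₀ ≤ dist ((b : X ≃ᵢ X) o) ((b' : X ≃ᵢ X) o)}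
    (fun c hc hchain _ => ⟨⋃₀ c, (pairwise_sUnion hchain.directedOn).2 hc,
      fun _ => subset_sUnion_of_mem⟩) {1} (pairwise_singleton _ _)
  refine ⟨T, h1T rfl, hT.prop, fun hsm => hdiv ?_⟩
  have hnear : ∀ h : H, ∃ b : T, dist ((b : X ≃ᵢ X) o) ((h : X ≃ᵢ X) o) < R₀ := by
    intro h
    by_contra! hc
    have hmem : h ∈ T := by
      have hins : (insert h T).Pairwise
          fun b b' : H => R₀ ≤ dist ((b : X ≃ᵢ X) o) ((b' : X ≃ᵢ X) o) :=
        pairwise_insert.2 ⟨hT.prop, fun b hb _ =>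
          ⟨by rw [dist_comm]; exact hc ⟨b, hb⟩, hc ⟨b, hb⟩⟩⟩
      exact hT.le_of_ge hins (subset_insert _ _) (mem_insert _ _)
    have := hc ⟨h, hmem⟩
    rw [dist_self] at this
    linarith
  choose b hb using hnear
  have := hfin.to_subtype
  generalize hF : {γ : X ≃ᵢ X | γ ∈ H ∧ dist o (γ o) ≤ R₀} = F at this
  have hf : ∀ h : H, ((b h : X ≃ᵢ X))⁻¹ * h ∈ F := by
    intro h
    rw [← hF]
    refine ⟨H.mul_mem (H.inv_mem (b h : H).2) h.2, ?_⟩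
    rw [← (b h : X ≃ᵢ X).dist_eq, ← IsometryEquiv.mul_apply, mul_inv_cancel_left]
    exact (hb h).le
  -- By maximality `H` is covered by the products of `T` with the finite set `F`, so its series is
  -- at most a constant times that of `T`.
  have hinj : Function.Injective fun h : H => ((b h, ⟨_, hf h⟩) : T × F) := by
    intro h h' heq
    obtain ⟨e1, e2⟩ := Prod.mk.inj heq
    have e3 : ((b h : X ≃ᵢ X))⁻¹ * h = ((b h' : X ≃ᵢ X))⁻¹ * h' := congrArg Subtype.val e2
    rw [e1] at e3
    exact Subtype.ext (mul_left_cancel e3)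
  have hprod := hsm.mul_of_nonneg (g := fun _ : F => Real.exp (s * R₀)) Summable.of_finite
    (fun _ => (Real.exp_pos _).le) (fun _ => (Real.exp_pos _).le)
  refine Summable.of_nonneg_of_le (fun _ => (Real.exp_pos _).le) (fun h => ?_)
    (hprod.comp_injective hinj)
  rw [Function.comp_apply, ← Real.exp_add]
  refine Real.exp_le_exp.2 ?_
  have h1 := dist_triangle o ((h : X ≃ᵢ X) o) ((b h : X ≃ᵢ X) o)
  rw [dist_comm ((h : X ≃ᵢ X) o)] at h1
  have h2 := mul_le_mul_of_nonneg_left (h1.trans (add_le_add le_rfl (hb h).le)) hs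
  dsimp only
  linarith

end HadamardSpace

/-! ### The entropy gap -/

theorem mainTheorem11 {X : Type*} [MetricSpace X] [ProperSpace X]
    (hX : HadamardSpace.IsHadamard X) (o : X) (Γ H : Subgroup (X ≃ᵢ X))
    (hdisc : DiscreteTopology Γ) (hrank : HadamardSpace.IsRankOneGroup Γ)
    (hH : H ≤ Γ) (hdiv : HadamardSpace.IsDivergent H o)
    (hlim : HadamardSpace.limitSet H o ⊂ HadamardSpace.limitSet Γ o) :
    HadamardSpace.criticalExponent H o < HadamardSpace.criticalExponent Γ o := by
  classical
  open HadamardSpace in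
  have hfin := finite_ball_of_discrete hdisc o
  obtain ⟨a, ha, U, R₀, hU, hR₀, hping⟩ := exists_pingpong hX o hrank hlim
  obtain ⟨htop, hns⟩ := hdiv
  have h0 := criticalExponent_nonneg H o
  have hbot : criticalExponent H o ≠ ⊥ := fun h => by simp [h] at h0
  have hδ := EReal.coe_toReal htop hbot
  set δ := (criticalExponent H o).toReal with hδd
  have hδ0 : 0 ≤ δ := EReal.toReal_nonneg h0
  obtain ⟨T, h1T, hsep, hT⟩ := exists_separated_not_summable hδ0 hR₀
    ((hfin R₀).subset fun γ hγ => ⟨hH hγ.1, hγ.2⟩) hns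
  -- The summand 1 pays for removing the identity; every other element of `T` moves `o` by at least
  -- `R₀`, being separated from it.
  obtain ⟨F, hF⟩ : ∃ F : Finset T, Real.exp (δ * dist o (a o)) + 1 <
      ∑ b ∈ F, Real.exp (-δ * dist o ((b : X ≃ᵢ X) o)) := by
    by_contra! hc
    exact hT (summable_of_sum_le (fun _ => (Real.exp_pos _).le) hc)
  set G : Finset T := F.erase ⟨1, h1T⟩ with hG
  have hGs : Real.exp (δ * dist o (a o)) <
      ∑ b ∈ G, Real.exp (-δ * dist o ((b : X ≃ᵢ X) o)) := by
    by_cases hm : (⟨1, h1T⟩ : T) ∈ F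
    · rw [← Finset.add_sum_erase F _ hm] at hF
      simp only [OneMemClass.coe_one, show dist o ((1 : X ≃ᵢ X) o) = 0 from dist_self o, mul_zero,
        Real.exp_zero] at hF
      linarith
    · rw [hG, Finset.erase_eq_of_notMem hm]
      linarith
  set S : Finset (X ≃ᵢ X) := G.image fun b : T => ((b : H) : X ≃ᵢ X) with hS
  have hinj : Function.Injective fun b : T => ((b : H) : X ≃ᵢ X) :=
    fun b b' h => Subtype.ext (Subtype.ext h)
  set A : ℝ → ℝ := fun s => ∑ b ∈ S, Real.exp (-s * (dist o (a o) + dist o (b o))) with hA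
  have hA1 : 1 < A δ := by
    have e1 : A δ = Real.exp (-δ * dist o (a o)) *
        ∑ b ∈ G, Real.exp (-δ * dist o ((b : X ≃ᵢ X) o)) := by
      simp only [hA]
      rw [hS, Finset.sum_image hinj.injOn, Finset.mul_sum]
      refine Finset.sum_congr rfl fun b _ => ?_
      rw [← Real.exp_add]; ring_nf
    have e2 := mul_lt_mul_of_pos_left hGs (Real.exp_pos (-δ * dist o (a o)))
    rw [← Real.exp_add, ← add_mul, neg_add_cancel, zero_mul, Real.exp_zero] at e2
    rwa [e1]
  have hAc : Continuous A := by fun_prop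
  obtain ⟨ε, hε, hball⟩ := Metric.eventually_nhds_iff.1
    ((hAc.tendsto δ).eventually (lt_mem_nhds hA1))
  have hlt : 1 < A (δ + ε / 2) := hball (by
    rw [Real.dist_eq, add_sub_cancel_left, abs_of_pos (by positivity)]; linarith)
  have hSG : ∀ b ∈ S, ∃ b' ∈ G, ((b' : H) : X ≃ᵢ X) = b := fun b hb => Finset.mem_image.1 hb
  -- The images `b U` are disjoint: `b⁻¹ * b'` is long by separation and hence maps `U` off `U`.
  have hlong : ∀ b b' : T, b ≠ b' → ∀ x ∈ U, ∀ y ∈ U,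
      ((b : H) : X ≃ᵢ X) x ≠ ((b' : H) : X ≃ᵢ X) y := by
    intro b b' hbb x hx y hy heq
    have hd := hsep b.2 b'.2 fun h => hbb (Subtype.ext h)
    refine (hping (((b : H) : X ≃ᵢ X)⁻¹ * ((b' : H) : X ≃ᵢ X))
      (H.mul_mem (H.inv_mem (b : H).2) (b' : H).2) ?_ y hy).1 ?_
    · rwa [← ((b : H) : X ≃ᵢ X).dist_eq, ← IsometryEquiv.mul_apply, mul_inv_cancel_left]
    · rw [IsometryEquiv.mul_apply, ← heq]
      have : ((b : H) : X ≃ᵢ X)⁻¹ (((b : H) : X ≃ᵢ X) x) = x :=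
        ((b : H) : X ≃ᵢ X).symm_apply_apply x
      rwa [this]
  have hns' := not_summable_of_pingpong (Γ := Γ) o ha hU (S := S) (s := δ + ε / 2) ?_ ?_ ?_
    (by positivity) hlt
  · rw [← hδ]
    have h1 : (δ : EReal) < ((δ + ε / 2 : ℝ) : EReal) := by exact_mod_cast (by linarith)
    refine h1.trans_le ?_
    by_contra! hc
    exact hns' (summable_of_criticalExponent_lt hfin hc)
  · intro b hb
    obtain ⟨b', -, rfl⟩ := hSG b hb
    exact hH (b' : H).2
  · intro b hb x hx
    obtain ⟨b', hb', rfl⟩ := hSG b hb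
    refine (hping _ (b' : H).2 ?_ x hx).2
    have := hsep h1T b'.2 fun h => (Finset.mem_erase.1 hb').1 (Subtype.ext h.symm)
    simpa using this
  · intro b hb b' hb' x hx y hy heq
    obtain ⟨c, -, rfl⟩ := hSG b hb
    obtain ⟨c', -, rfl⟩ := hSG b' hb'
    by_contra hne
    exact hlong c c' (fun h => hne (by rw [h])) x hx y hy heq
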